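/- Let $C_3$ act on the polynomial ring $\mathbb F_2[a,b]$, where $\deg a=\deg b=1$, by letting a generator act as the ring automorphism $a\mapsto b$, $b\mapsto a+b$, and let $H=\mathbb F_2[a,b]^{C_3}$, which is the cohomology ring $H^*(BA_4;\mathbb F_2)$. The total Steenrod square $\mathrm{Sq}$ is the ring homomorphism $\mathbb F_2[a,b]\to\mathbb F_2[a,b]$ with $\mathrm{Sq}(a)=a+a^2$ and $\mathrm{Sq}(b)=b+b^2$; it restricts to $H$, and for homogeneous $f$ of degree $d$ the class $\mathrm{Sq}^1(f)$ is the homogeneous component of degree $d+1$ of $\mathrm{Sq}(f)$. An ideal $I\subset H$ is Steenrod closed if $\mathrm{Sq}(I)\subset I$. It is a parameter ideal, with parameters of degrees $p,q$, if $I=\langle X,Y\rangle$ for some homogeneous elements $X,Y\in H$ of degrees $p,q>0$ and $H/I$ is finite-dimensional over $\mathbb F_2$. Put $u=a^2+ab+b^2$, $v=a^2b+ab^2$, and define $x_n\in H$ for $n\ge 1$ by $x_1=u$ and $x_{n+1}=u\,x_n^2+\mathrm{Sq}^1(x_n)^2$. **Theorem.** The set of Steenrod closed parameter ideals in $H$ is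 the disjoint union of the following three families: 1. the *fibered ideals* $\langle v^k,u^l\rangle$ with $l\ge 1$ and $1\le k\le 2^t$, where $2^t$ is the largest power of $2$ dividing $l$; 2. the *twisted ideals* $\langle x_n,\mathrm{Sq}^1(x_n)\rangle$ with $n\ge 2$; 3. the *mixed ideals* $\langle v^i x_n^{2^m},\,x_{n+1}^{2^{m-1}}\rangle$ with $m\ge 1$ and either $n=1$ and $1\le i<2^{m-1}$, or $n\ge 2$ and $0\le i<2^{m-1}$. Each Steenrod closed parameter ideal is written uniquely in this way, i.e. within each family different indices ($(k,l)$, $n$, and $(n,m,i)$ respectively) give different ideals. Moreover, for each pair $(p,q)$ of natural numbers there is at most one Steenrod closed parameter ideal in $H$ with parameters of degrees $p$ and $q$. -/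

import Mathlib

noncomputable section

namespace A4Cohomology

open MvPolynomial

/-- The polynomial ring `𝔽₂[a,b]`, that is, the mod-2 cohomology ring of `(ℤ/2)²`,
with `a` and `b` in degree one. -/
abbrev Poly : Type := MvPolynomial (Fin 2) (ZMod 2)

/-- The generator `a`. -/
abbrev a : Poly := X 0

/-- The generator `b`. -/
abbrev b : Poly := X 1

/-- The action of a generator of `C₃` on `𝔽₂[a,b]`: `a ↦ b`, `b ↦ a + b`. -/
def rot : Poly →ₐ[ZMod 2] Poly := aeval ![b, a + b]

/-- The total Steenrod square on `𝔽₂[a,b]`: the ring homomorphism with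
`a ↦ a + a²`, `b ↦ b + b²`. -/
def totalSqPoly : Poly →ₐ[ZMod 2] Poly := aeval ![a + a ^ 2, b + b ^ 2]

/-- The Steenrod square `Sq^k` on `𝔽₂[a,b]`: on the homogeneous part of degree `n` it is the
component of degree `n + k` of the total Steenrod square. -/
def sqPoly (k : ℕ) (f : Poly) : Poly :=
  ∑ n ∈ Finset.range (f.totalDegree + 1),
    homogeneousComponent (n + k) (totalSqPoly (homogeneousComponent n f))

theorem two_eq_zero : (2 : Poly) = 0 := CharTwo.two_eq_zero

@[simp] theorem rot_a : rot a = b := by simp [rot]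

@[simp] theorem rot_b : rot b = a + b := by simp [rot]

@[simp] theorem totalSqPoly_a : totalSqPoly a = a + a ^ 2 := by simp [totalSqPoly]

@[simp] theorem totalSqPoly_b : totalSqPoly b = b + b ^ 2 := by simp [totalSqPoly]

/-- The given automorphism has order dividing three, so it does define an action of `C₃`. -/
theorem rot_rot_rot (f : Poly) : rot (rot (rot f)) = f := by
  have h : (rot.comp rot).comp rot = AlgHom.id (ZMod 2) Poly := by
    apply MvPolynomial.algHom_ext
    intro i
    fin_cases i
    · change rot (rot (rot a)) = a
      simp only [rot_a, rot_b, map_add]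
      linear_combination b * two_eq_zero
    · change rot (rot (rot b)) = b
      simp only [rot_a, rot_b, map_add]
      linear_combination (a + b) * two_eq_zero
  exact DFunLike.congr_fun h f

theorem totalSqPoly_rot (f : Poly) : totalSqPoly (rot f) = rot (totalSqPoly f) := by
  have h : totalSqPoly.comp rot = rot.comp totalSqPoly := by
    apply MvPolynomial.algHom_ext
    intro i
    fin_cases i
    · change totalSqPoly (rot a) = rot (totalSqPoly a)
      simp only [rot_a, totalSqPoly_a, totalSqPoly_b, map_add, map_pow]
    · change totalSqPoly (rot b) = rot (totalSqPoly b)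
      simp only [rot_b, totalSqPoly_a, totalSqPoly_b, map_add, map_pow]
      linear_combination (-(a * b)) * two_eq_zero
  exact DFunLike.congr_fun h f

theorem rot_isHomogeneous {f : Poly} {n : ℕ} (hf : f.IsHomogeneous n) :
    (rot f).IsHomogeneous n := by
  have h := hf.aeval (S := ZMod 2) (τ := Fin 2) ![b, a + b] (n := 1) (by
    intro i
    fin_cases i
    · exact isHomogeneous_X _ _
    · exact (isHomogeneous_X _ _).add (isHomogeneous_X _ _))
  simpa [rot] using h

theorem homogeneousComponent_rot (n : ℕ) (f : Poly) :
    homogeneousComponent n (rot f) = rot (homogeneousComponent n f) := by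
  conv_lhs => rw [← sum_homogeneousComponent f]
  rw [map_sum, map_sum]
  have h : ∀ i, homogeneousComponent n (rot (homogeneousComponent i f))
      = if i = n then rot (homogeneousComponent i f) else 0 := by
    intro i
    rw [homogeneousComponent_of_mem (rot_isHomogeneous (homogeneousComponent_isHomogeneous i f))]
    simp [eq_comm]
  simp only [h, Finset.sum_ite_eq', Finset.mem_range]
  split_ifs with hn
  · rfl
  · rw [homogeneousComponent_eq_zero n f (by omega), map_zero]

/-- The ring `𝔽₂[a,b]^{C₃}`, that is, the cohomology ring `H^*(BA₄; 𝔽₂)`. A polynomial is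
invariant under `C₃` if and only if it is fixed by the generator of `C₃`. -/
abbrev H : Type := AlgHom.equalizer rot (AlgHom.id (ZMod 2) Poly)

theorem mem_iff (f : Poly) :
    f ∈ AlgHom.equalizer rot (AlgHom.id (ZMod 2) Poly) ↔ rot f = f := Iff.rfl

/-- The total Steenrod square on `H^*(BA₄; 𝔽₂)`, the restriction of the one on `𝔽₂[a,b]`. -/
def totalSq : H →ₐ[ZMod 2] H :=
  (totalSqPoly.comp (Subalgebra.val _)).codRestrict _ (by
    intro f
    change rot (totalSqPoly f.1) = totalSqPoly f.1
    rw [← totalSqPoly_rot, (mem_iff _).1 f.2])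

theorem sqPoly_mem (k : ℕ) (f : H) : rot (sqPoly k f.1) = sqPoly k f.1 := by
  simp only [sqPoly, map_sum]
  refine Finset.sum_congr rfl fun n _ => ?_
  rw [← homogeneousComponent_rot, ← totalSqPoly_rot, ← homogeneousComponent_rot,
    (mem_iff _).1 f.2]

/-- The Steenrod square `Sq^k` on `H^*(BA₄; 𝔽₂)`. -/
def sq (k : ℕ) (f : H) : H := ⟨sqPoly k f.1, sqPoly_mem k f⟩

/-- The class `u = a² + ab + b²` of degree 2. -/
def u : H := ⟨a ^ 2 + a * b + b ^ 2, by
  rw [mem_iff]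
  simp only [map_add, map_mul, map_pow, rot_a, rot_b]
  linear_combination (a * b + b ^ 2) * two_eq_zero⟩

/-- The class `v = a²b + ab²` of degree 3. -/
def v : H := ⟨a ^ 2 * b + a * b ^ 2, by
  rw [mem_iff]
  simp only [map_add, map_mul, map_pow, rot_a, rot_b]
  linear_combination (a * b ^ 2 + b ^ 3) * two_eq_zero⟩

/-- The sequence `x₁ = u`, `x_{n+1} = u x_n² + Sq¹(x_n)²` (the value at `0` is irrelevant). -/
def x : ℕ → H
  | 0 => 1
  | 1 => u
  | n + 2 => u * x (n + 1) ^ 2 + sq 1 (x (n + 1)) ^ 2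

/-- An ideal is Steenrod closed if the total Steenrod square maps it into itself. -/
def IsSteenrodClosed (I : Ideal H) : Prop := ∀ f ∈ I, totalSq f ∈ I

/-- `I` is generated by a homogeneous system of parameters of degrees `p` and `q`: by two
homogeneous elements of these positive degrees such that the quotient is finite over `𝔽₂`.
(Two is the Krull dimension of `𝔽₂[a,b]^{C₃}`.) -/
def HasParameterDegrees (I : Ideal H) (p q : ℕ) : Prop :=
  0 < p ∧ 0 < q ∧ ∃ X Y : H, (X : Poly).IsHomogeneous p ∧ (Y : Poly).IsHomogeneous q ∧
    I = Ideal.span {X, Y} ∧ Module.Finite (ZMod 2) (H ⧸ I)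

/-- A parameter ideal: an ideal generated by a homogeneous system of parameters. -/
def IsParameterIdeal (I : Ideal H) : Prop := ∃ p q : ℕ, HasParameterDegrees I p q

/-- The ideal `⟨v^k, u^l⟩`, with `p = (k, l)`. -/
def fiberedIdeal (p : ℕ × ℕ) : Ideal H := Ideal.span {v ^ p.1, u ^ p.2}

/-- The pairs `(k, l)` with `l ≥ 1` and `1 ≤ k ≤ 2^t`, where `2^t` is the largest power of two
that divides `l`. -/
def fiberedIndex : Set (ℕ × ℕ) :=
  {p | 1 ≤ p.2 ∧ 1 ≤ p.1 ∧ p.1 ≤ 2 ^ padicValNat 2 p.2}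

/-- The ideal `⟨x_n, Sq¹(x_n)⟩`. -/
def twistedIdeal (n : ℕ) : Ideal H := Ideal.span {x n, sq 1 (x n)}

/-- The indices of the twisted ideals: `n ≥ 2`. -/
def twistedIndex : Set ℕ := {n | 2 ≤ n}

/-- The ideal `⟨v^i x_n^{2^m}, x_{n+1}^{2^{m-1}}⟩` with `p = (n, m, i)` (used for `m ≥ 1`). -/
def mixedIdeal (p : ℕ × ℕ × ℕ) : Ideal H :=
  Ideal.span {v ^ p.2.2 * x p.1 ^ 2 ^ p.2.1, x (p.1 + 1) ^ 2 ^ (p.2.1 - 1)}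

/-- The triples `(n, m, i)` with `m ≥ 1` and either `n = 1`, `1 ≤ i < 2^{m-1}` or
`n ≥ 2`, `0 ≤ i < 2^{m-1}`. -/
def mixedIndex : Set (ℕ × ℕ × ℕ) :=
  {p | 1 ≤ p.2.1 ∧ ((p.1 = 1 ∧ 1 ≤ p.2.2 ∧ p.2.2 < 2 ^ (p.2.1 - 1)) ∨
    (2 ≤ p.1 ∧ p.2.2 < 2 ^ (p.2.1 - 1)))}

/-- The set of fibered ideals. -/
def fiberedIdeals : Set (Ideal H) := fiberedIdeal '' fiberedIndex

/-- The set of twisted ideals. -/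
def twistedIdeals : Set (Ideal H) := twistedIdeal '' twistedIndex

/-- The set of mixed ideals. -/
def mixedIdeals : Set (Ideal H) := mixedIdeal '' mixedIndex

end A4Cohomology

end

/-!
# Steenrod closed parameter ideals in the cohomology of `A₄`

The ring `H` is a domain in which `v`, the product of the three nonzero linear forms over `𝔽₂`,
satisfies `Sq v = v (1 + u + v)`. Restriction to the line `a = 0` identifies `H / v` with the subring
of `𝔽₂[t]` of polynomials without linear term. Modulo a homogeneous parameter ideal the class
`1 + u + v` is a unit, so if `I` is a Steenrod closed parameter ideal, then so is `I : v`. The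
classification is an induction along the chain `I ⊆ I : v ⊆ I : v² ⊆ ⋯`.

* `exists_generators_v_mul`: a closed parameter ideal has homogeneous generators `A`, `vB`, and then
  `I : v = ⟨A, B⟩`. Subtracting a multiple of one generator from the other achieves this, unless the
  degrees are `p` and `p + 1` and both generators are nonzero modulo `v`, since `H` has no element of
  degree one. In that case `Sq¹ Sq¹ = 0` (for `p` even) or the identity
  `v Sq^{p-1} X = (Sq¹ X)² + p u X²` (for `p` odd) contradicts closedness.
* `eq_span_of_v_mem`: the closed parameter ideals that contain `v` are the ideals `⟨v, u^l⟩`.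
* `exists_eq_chainIdeal`, `exists_eq_fiberedIdeal`: given `I : v` there is at most one possibility
  for `I`. If `C`, `D` are the generators of `I : v` in order of degree, then `I` is `⟨C, vD⟩` or
  `⟨D + hC, vC⟩` for some homogeneous `h`, and applying `Sq` to the first generator gives a
  divisibility relation in `𝔽₂[t]`. It involves the power of `t` in `1 + (1 + t)^k`, which is the
  largest power of two dividing `k`, and this is where the powers of two in the answer come from.

Starting from `⟨v, u^l⟩` with `l = 2^t s`, `s` odd, one finds the fibered ideals `⟨v^k, u^l⟩` with
`k ≤ 2^t`, and no others if `s > 1`. If `s = 1`, the chain goes on with the ideals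
`⟨v^i x_n^{2M}, x_{n+1}^M⟩`, where `1 ≤ i ≤ M` and `M` is a power of two: by
`x_{n+2} = u x_{n+1}² + v² x_n⁴`, the one with `i = M` is also generated by `x_{n+1}^M` and
`x_{n+2}^{M/2}`, which have the shape of the next block with `i = 0`. The chain ends with a twisted
ideal, at `M = 1`. These ideals are closed because `(1 + u + v) Sq(x_{n+1})` is an explicit
polynomial in `u`, `v`, `x_n` and `x_{n+1}` (`dickson_mul_totalSq_x`).

The two degrees of the generators are always distinct, so they are invariants of the ideal. A
comparison of powers of two shows that they determine the indices, which gives disjointness,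
uniqueness of the indices, and the uniqueness of the ideal with given degrees.
-/

noncomputable section

namespace A4Cohomology

open MvPolynomial

/-! ### Homogeneous polynomials over the field with two elements -/

theorem homogeneousComponent_mul_of_isHomogeneous {f g : Poly} {p : ℕ} (hg : g.IsHomogeneous p)
    (n : ℕ) : homogeneousComponent n (f * g) =
      if p ≤ n then homogeneousComponent (n - p) f * g else 0 := by
  let _ : GradedAlgebra (homogeneousSubmodule (Fin 2) (ZMod 2)) := MvPolynomial.gradedAlgebra
  have key : ∀ (k : ℕ) (h : Poly), homogeneousComponent k h =
      (DirectSum.decompose (homogeneousSubmodule (Fin 2) (ZMod 2)) h k : Poly) := by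
    intro k h
    exact (decomposition.decompose'_apply h k).symm
  have hg' : g ∈ homogeneousSubmodule (Fin 2) (ZMod 2) p := hg
  rw [key, key, DirectSum.coe_decompose_mul_of_right_mem _ n hg']

/-- Induction on homogeneous polynomials over `𝔽₂`: they are the sums of monomials. -/
theorem homogeneous_induction {P : ℕ → Poly → Prop} (zero : ∀ d, P d 0)
    (add : ∀ d f g, P d f → P d g → P d (f + g)) (one : P 0 1)
    (mul : ∀ d f i, f.IsHomogeneous d → P d f → P (d + 1) (X i * f)) {f : Poly} {d : ℕ}
    (hf : f.IsHomogeneous d) : P d f := by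
  have hpow : ∀ (i : Fin 2) (k e : ℕ) (g : Poly), g.IsHomogeneous e → P e g →
      P (e + k) (X i ^ k * g) := by
    intro i k e g hg hP
    induction k with
    | zero => simpa using hP
    | succ k ih =>
      have h := mul (e + k) (X i ^ k * g) i
        (by simpa [add_comm] using (isHomogeneous_X_pow (R := ZMod 2) i k).mul hg) ih
      rw [pow_succ', mul_assoc]
      exact h
  have hmon : ∀ s : Fin 2 →₀ ℕ, P s.degree (monomial s 1) := by
    intro s
    have h0 := hpow 1 (s 1) 0 1 (isHomogeneous_one _ _) one
    have h1 := hpow 0 (s 0) _ _ (by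
      simpa using (isHomogeneous_X_pow (R := ZMod 2) (1 : Fin 2) (s 1))) h0
    have e1 : s.degree = 0 + s 1 + s 0 := by
      rw [Finsupp.degree_eq_sum, Fin.sum_univ_two]; ring
    have e2 : (monomial s (1 : ZMod 2) : Poly) = X 0 ^ s 0 * (X 1 ^ s 1 * 1) := by
      rw [monomial_eq, Finsupp.prod_fintype _ _ (by simp), Fin.prod_univ_two]
      simp
    rw [e1, e2]
    exact h1
  have hc : ∀ c : ZMod 2, c = 0 ∨ c = 1 := by decide
  rw [f.as_sum]
  have hsum : ∀ T : Finset (Fin 2 →₀ ℕ), T ⊆ f.support →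
      P d (∑ s ∈ T, monomial s (coeff s f)) := by
    intro T
    induction T using Finset.induction_on with
    | empty => intro _; simpa using zero d
    | insert s T hs ih =>
      intro hT
      rw [Finset.sum_insert hs]
      refine add _ _ _ ?_ (ih fun y hy => hT (Finset.mem_insert_of_mem hy))
      have hs' : coeff s f ≠ 0 := mem_support_iff.1 (hT (Finset.mem_insert_self _ _))
      rw [(hc _).resolve_left hs']
      have : s.degree = d := by
        by_contra hne
        exact hs' (hf.coeff_eq_zero hne)
      rw [← this]
      exact hmon s
  exact hsum _ (Finset.Subset.refl _)

/-! ### Restriction to the line `a = 0` -/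

/-- Restriction of polynomials to the line `a = 0`, with `b` as the coordinate. -/
def restrict : Poly →ₐ[ZMod 2] Polynomial (ZMod 2) := aeval ![0, Polynomial.X]

@[simp] theorem restrict_a : restrict a = 0 := by simp [restrict]

@[simp] theorem restrict_b : restrict b = Polynomial.X := by simp [restrict]

theorem restrict_eq_zero_or {f : Poly} {d : ℕ} (hf : f.IsHomogeneous d) :
    restrict f = 0 ∨ restrict f = Polynomial.X ^ d := by
  refine homogeneous_induction (P := fun d f => restrict f = 0 ∨ restrict f = Polynomial.X ^ d)
    ?_ ?_ ?_ ?_ hf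
  · intro d; simp
  · rintro d f g (hf | hf) (hg | hg) <;> simp [hf, hg, CharTwo.add_self_eq_zero]
  · simp
  · intro d f i _ h
    fin_cases i
    · left
      change restrict (a * f) = 0
      simp
    · change restrict (b * f) = 0 ∨ restrict (b * f) = _
      rcases h with h | h
      · simp [h]
      · right; rw [map_mul, h, restrict_b, pow_succ']

theorem a_dvd_of_restrict_eq_zero {f : Poly} (hf : restrict f = 0) : a ∣ f := by
  let e : Polynomial (ZMod 2) →ₐ[ZMod 2] Poly := Polynomial.aeval b
  have h : (Ideal.Quotient.mkₐ (ZMod 2) (Ideal.span {a})).comp (e.comp restrict)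
      = Ideal.Quotient.mkₐ (ZMod 2) (Ideal.span {a}) := by
    apply MvPolynomial.algHom_ext
    intro i
    fin_cases i
    · change Ideal.Quotient.mk _ (e (restrict a)) = Ideal.Quotient.mk _ a
      rw [restrict_a, map_zero, map_zero, eq_comm, Ideal.Quotient.eq_zero_iff_mem]
      exact Ideal.mem_span_singleton_self a
    · change Ideal.Quotient.mk _ (e (restrict b)) = Ideal.Quotient.mk _ b
      simp [e]
  have h' := DFunLike.congr_fun h f
  change Ideal.Quotient.mk _ (e (restrict f)) = Ideal.Quotient.mk _ f at h'
  rw [hf, map_zero, map_zero, eq_comm, Ideal.Quotient.eq_zero_iff_mem,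
    Ideal.mem_span_singleton] at h'
  exact h'

theorem isRelPrime_a_b : IsRelPrime a b := by
  rw [Irreducible.isRelPrime_iff_not_dvd (MvPolynomial.X_prime (i := (0 : Fin 2)) (R := ZMod 2)).irreducible]
  rintro ⟨g, hg⟩
  have := congrArg restrict hg
  simp at this

theorem coe_u : (u : Poly) = a ^ 2 + a * b + b ^ 2 := rfl

theorem coe_v : (v : Poly) = a * b * (a + b) := by
  change a ^ 2 * b + a * b ^ 2 = _
  ring

theorem isRelPrime_a_add : IsRelPrime a (a + b) := by
  intro d h1 h2
  exact isRelPrime_a_b h1 ((dvd_add_right h1).1 h2)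

theorem isRelPrime_b_add : IsRelPrime b (a + b) := by
  intro d h1 h2
  exact isRelPrime_a_b ((dvd_add_left h1).1 h2) h1

theorem isRelPrime_v_u : IsRelPrime (v : Poly) (u : Poly) := by
  rw [coe_v, coe_u]
  have ha : IsRelPrime a (a ^ 2 + a * b + b ^ 2) := by
    have h := (isRelPrime_a_b.pow_right (n := 2))
    intro d h1 h2
    refine h h1 ((dvd_add_right ?_).1 h2)
    exact dvd_add (dvd_pow h1 two_ne_zero) (h1.mul_right b)
  have hb : IsRelPrime b (a ^ 2 + a * b + b ^ 2) := by
    have h := (isRelPrime_a_b.symm.pow_right (n := 2))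
    intro d h1 h2
    refine h h1 ((dvd_add_left (b := a ^ 2)
      (dvd_add (h1.mul_left a) (dvd_pow h1 two_ne_zero))).1 ?_)
    rwa [add_assoc] at h2
  have hc : IsRelPrime (a + b) (a ^ 2 + a * b + b ^ 2) := by
    have h := isRelPrime_b_add.symm.pow_right (n := 2)
    intro d h1 h2
    refine h h1 ((dvd_add_right (c := b ^ 2) (h1.mul_left a)).1 ?_)
    convert h2 using 1
    ring
  exact (ha.mul_left hb).mul_left hc

/-! ### The ring of invariants -/

theorem isHomogeneous_u : (u : Poly).IsHomogeneous 2 := by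
  rw [coe_u]
  have ha : a.IsHomogeneous 1 := isHomogeneous_X _ _
  have hb : b.IsHomogeneous 1 := isHomogeneous_X _ _
  exact ((ha.pow 2).add (ha.mul hb)).add (hb.pow 2)

theorem isHomogeneous_v : (v : Poly).IsHomogeneous 3 := by
  rw [coe_v]
  have ha : a.IsHomogeneous 1 := isHomogeneous_X _ _
  have hb : b.IsHomogeneous 1 := isHomogeneous_X _ _
  exact (ha.mul hb).mul (ha.add hb)

/-- The class `w = a³ + a²b + b³` of degree 3, which generates the invariants together with `u`
and `v`. -/
def w : H := ⟨a ^ 3 + a ^ 2 * b + b ^ 3, by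
  rw [mem_iff]
  simp only [map_add, map_mul, map_pow, rot_a, rot_b]
  linear_combination (a * b ^ 2 * 2 + a ^ 2 * b + b ^ 3) * two_eq_zero⟩

theorem coe_w : (w : Poly) = a ^ 3 + a ^ 2 * b + b ^ 3 := rfl

theorem isHomogeneous_w : (w : Poly).IsHomogeneous 3 := by
  rw [coe_w]
  have ha : a.IsHomogeneous 1 := isHomogeneous_X _ _
  have hb : b.IsHomogeneous 1 := isHomogeneous_X _ _
  exact ((ha.pow 3).add ((ha.pow 2).mul hb)).add (hb.pow 3)

/-- Restriction of invariants to the line `a = 0`. -/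
def res : H →ₐ[ZMod 2] Polynomial (ZMod 2) := restrict.comp (Subalgebra.val _)

theorem res_apply (f : H) : res f = restrict (f : Poly) := rfl

@[simp] theorem res_u : res u = Polynomial.X ^ 2 := by
  rw [res_apply, coe_u]; simp

@[simp] theorem res_v : res v = 0 := by
  rw [res_apply, coe_v]; simp

@[simp] theorem res_w : res w = Polynomial.X ^ 3 := by
  rw [res_apply, coe_w]; simp

theorem v_ne_zero : v ≠ 0 := by
  intro h
  have h1 : (v : Poly) = 0 := by rw [h]; rfl
  rw [coe_v] at h1
  have hab : a + b ≠ 0 := by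
    intro h2
    have := congrArg restrict h2
    simp at this
  simp [hab, X_ne_zero] at h1

theorem dvd_of_coe_dvd {f g : H} (h : (f : Poly) ∣ g) : f ∣ g := by
  by_cases hf : (f : Poly) = 0
  · have hg : (g : Poly) = 0 := by rw [hf] at h; exact zero_dvd_iff.1 h
    have : g = 0 := Subtype.ext hg
    rw [this]; exact dvd_zero f
  · obtain ⟨k, hk⟩ := h
    have hk' : rot k = k := by
      apply mul_left_cancel₀ hf
      rw [← hk]
      have h1 : rot (g : Poly) = g := (mem_iff _).1 g.2
      have h2 : rot (f : Poly) = f := (mem_iff _).1 f.2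
      rw [hk, map_mul, h2] at h1
      rw [hk, h1]
    exact ⟨⟨k, hk'⟩, Subtype.ext hk⟩

/-- An invariant that vanishes on one line over `𝔽₂` vanishes on all three. -/
theorem v_dvd_iff {f : H} : v ∣ f ↔ res f = 0 := by
  constructor
  · rintro ⟨g, rfl⟩
    simp
  · intro h
    apply dvd_of_coe_dvd
    have h1 : rot (f : Poly) = f := (mem_iff _).1 f.2
    have ha : a ∣ (f : Poly) := a_dvd_of_restrict_eq_zero h
    have hb : b ∣ (f : Poly) := by
      have := map_dvd rot ha
      rwa [h1, rot_a] at this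
    have hc : a + b ∣ (f : Poly) := by
      have := map_dvd rot hb
      rwa [h1, rot_b] at this
    rw [coe_v]
    exact (isRelPrime_a_add.mul_left isRelPrime_b_add).mul_dvd (isRelPrime_a_b.mul_dvd ha hb) hc

theorem dvd_of_dvd_mul {f g h : H} (hfg : IsRelPrime (f : Poly) g) (hd : f ∣ g * h) : f ∣ h := by
  apply dvd_of_coe_dvd
  obtain ⟨k, hk⟩ := hd
  apply hfg.dvd_of_dvd_mul_left
  exact ⟨(k : Poly), by rw [← MulMemClass.coe_mul, hk]; rfl⟩

/-- There is no invariant of degree one. -/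
theorem eq_zero_of_isHomogeneous_one {f : H} (hf : (f : Poly).IsHomogeneous 1) : f = 0 := by
  have key : ∃ c d : ZMod 2, (f : Poly) = C c * a + C d * b := by
    refine homogeneous_induction (P := fun n f => n = 1 → ∃ c d : ZMod 2, f = C c * a + C d * b)
      ?_ ?_ ?_ ?_ hf rfl
    · exact fun _ _ => ⟨0, 0, by simp⟩
    · intro n f g hf hg hn
      obtain ⟨c, d, rfl⟩ := hf hn
      obtain ⟨c', d', rfl⟩ := hg hn
      exact ⟨c + c', d + d', by simp only [map_add]; ring⟩
    · intro h; omega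
    · intro n f i hf _ hn
      have hn0 : n = 0 := by omega
      subst hn0
      have := totalDegree_eq_zero_iff_eq_C.1 ((totalDegree_zero_iff_isHomogeneous _).2 hf)
      rw [this]
      fin_cases i
      · exact ⟨coeff 0 f, 0, by simp [mul_comm]⟩
      · exact ⟨0, coeff 0 f, by simp [mul_comm]⟩
  obtain ⟨c, d, hcd⟩ := key
  have h1 : rot (f : Poly) = f := (mem_iff _).1 f.2
  have hC : ∀ c : ZMod 2, rot (C c) = C c := fun c => by
    rw [← MvPolynomial.algebraMap_eq, AlgHom.commutes]
  rw [hcd] at h1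
  simp only [map_add, map_mul, hC, rot_a, rot_b] at h1
  have e0 := congrArg (MvPolynomial.eval ![(1 : ZMod 2), 0]) h1
  have e1 := congrArg (MvPolynomial.eval ![(0 : ZMod 2), 1]) h1
  simp at e0 e1
  apply Subtype.ext
  subst e0
  have : d = 0 := by simpa using e1
  subst this
  rw [hcd]; simp

/-- The restriction of the invariants to a line misses only the first power of the coordinate. -/
theorem exists_res_eq_pow {d : ℕ} (hd : d ≠ 1) :
    ∃ f : H, (f : Poly).IsHomogeneous d ∧ res f = Polynomial.X ^ d := by
  rcases Nat.even_or_odd' d with ⟨k, rfl | rfl⟩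
  · exact ⟨u ^ k, by simpa using isHomogeneous_u.pow k, by simp [← pow_mul]⟩
  · obtain ⟨k, rfl⟩ : ∃ j, k = j + 1 := ⟨k - 1, by omega⟩
    refine ⟨u ^ k * w, ?_, ?_⟩
    · have := (isHomogeneous_u.pow k).mul isHomogeneous_w
      rwa [show 2 * k + 3 = 2 * (k + 1) + 1 by ring] at this
    · rw [map_mul, map_pow, res_u, res_w, ← pow_mul, ← pow_add]
      rfl

/-- The homogeneous component of degree `n` of an invariant. -/
def comp (n : ℕ) : H →ₗ[ZMod 2] H where
  toFun f := ⟨homogeneousComponent n (f : Poly), by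
    rw [mem_iff, ← homogeneousComponent_rot, (mem_iff _).1 f.2]⟩
  map_add' f g := Subtype.ext (map_add _ _ _)
  map_smul' c f := Subtype.ext (map_smul (homogeneousComponent n) c (f : Poly))

theorem coe_comp (n : ℕ) (f : H) : (comp n f : Poly) = homogeneousComponent n (f : Poly) := rfl

theorem comp_isHomogeneous (n : ℕ) (f : H) : (comp n f : Poly).IsHomogeneous n :=
  homogeneousComponent_isHomogeneous n _

theorem comp_eq_self {n : ℕ} {f : H} (hf : (f : Poly).IsHomogeneous n) : comp n f = f :=
  Subtype.ext (homogeneousComponent_eq_self hf)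

theorem comp_eq_zero {m n : ℕ} {f : H} (hf : (f : Poly).IsHomogeneous n) (h : m ≠ n) :
    comp m f = 0 := by
  apply Subtype.ext
  rw [coe_comp, homogeneousComponent_of_mem hf, if_neg h]
  rfl

theorem comp_mul {f g : H} {p : ℕ} (hg : (g : Poly).IsHomogeneous p) (n : ℕ) :
    comp n (f * g) = if p ≤ n then comp (n - p) f * g else 0 := by
  apply Subtype.ext
  rw [coe_comp, MulMemClass.coe_mul, homogeneousComponent_mul_of_isHomogeneous hg]
  split_ifs <;> rfl

theorem comp_mul_of_add_eq {f g : H} {p k n : ℕ} (hg : (g : Poly).IsHomogeneous p)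
    (h : k + p = n) : comp n (f * g) = comp k f * g := by
  rw [comp_mul hg, if_pos (by omega), ← h, Nat.add_sub_cancel]

theorem comp_mul_of_lt {f g : H} {p n : ℕ} (hg : (g : Poly).IsHomogeneous p)
    (h : n < p) : comp n (f * g) = 0 := by
  rw [comp_mul hg, if_neg (by omega)]

theorem coeff_one_res (f : H) : (res f).coeff 1 = 0 := by
  have h : ∀ n, (res (comp n f)).coeff 1 = 0 := by
    intro n
    by_cases hn : n = 1
    · subst hn
      rw [eq_zero_of_isHomogeneous_one (comp_isHomogeneous 1 f)]
      simp
    · rcases restrict_eq_zero_or (comp_isHomogeneous n f) with h | h <;> rw [res_apply, h]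
      · simp
      · rw [Polynomial.coeff_X_pow, if_neg (Ne.symm hn)]
  rw [res_apply, ← sum_homogeneousComponent (f : Poly), map_sum, Polynomial.finsetSum_coeff]
  exact Finset.sum_eq_zero fun n _ => h n

theorem exists_eq_v_mul {f : H} {n : ℕ} (hf : (f : Poly).IsHomogeneous n) (h : res f = 0)
    (h0 : f ≠ 0) : ∃ (g : H) (k : ℕ), f = v * g ∧ (g : Poly).IsHomogeneous k ∧ k + 3 = n := by
  obtain ⟨g, rfl⟩ := v_dvd_iff.2 h
  by_cases hn : 3 ≤ n
  · have h1 := comp_eq_self hf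
    rw [mul_comm, comp_mul_of_add_eq isHomogeneous_v (Nat.sub_add_cancel hn)] at h1
    have := mul_right_cancel₀ v_ne_zero h1
    refine ⟨g, n - 3, rfl, ?_, by omega⟩
    rw [← this]
    exact comp_isHomogeneous _ _
  · have h1 := comp_eq_self hf
    rw [mul_comm, comp_mul_of_lt isHomogeneous_v (by omega)] at h1
    exact absurd (by rw [mul_comm, h1]) h0

/-! ### Steenrod squares -/

/-- The derivation of `𝔽₂[a,b]` with `a ↦ a²` and `b ↦ b²`; it is `Sq¹`. -/
def sqOneDer : Derivation (ZMod 2) Poly Poly := mkDerivation (ZMod 2) ![a ^ 2, b ^ 2]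

theorem sqOneDer_X (i : Fin 2) : sqOneDer (X i) = X i ^ 2 := by
  fin_cases i <;> simp [sqOneDer]

theorem totalSqPoly_X (i : Fin 2) : totalSqPoly (X i) = X i + X i ^ 2 := by
  fin_cases i
  · exact totalSqPoly_a
  · exact totalSqPoly_b

theorem homogeneousComponent_totalSqPoly_X_mul {i : Fin 2} (f : Poly) (k : ℕ) :
    homogeneousComponent k (totalSqPoly (X i * f)) =
      (if 1 ≤ k then homogeneousComponent (k - 1) (totalSqPoly f) * X i else 0) +
      (if 2 ≤ k then homogeneousComponent (k - 2) (totalSqPoly f) * X i ^ 2 else 0) := by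
  have e : totalSqPoly (X i * f) = totalSqPoly f * X i + totalSqPoly f * X i ^ 2 := by
    rw [map_mul, totalSqPoly_X]; ring
  rw [e, map_add, homogeneousComponent_mul_of_isHomogeneous (isHomogeneous_X (ZMod 2) i),
    homogeneousComponent_mul_of_isHomogeneous (isHomogeneous_X_pow i 2)]

/-- The linear forms over `𝔽₂` are the roots of `T³ + uT + v`. -/
theorem coe_v_mul_X (i : Fin 2) : (v : Poly) * X i = X i ^ 4 + (u : Poly) * X i ^ 2 := by
  rw [coe_v, coe_u]
  fin_cases i
  · change a * b * (a + b) * a = a ^ 4 + (a ^ 2 + a * b + b ^ 2) * a ^ 2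
    linear_combination (-a ^ 4) * two_eq_zero
  · change a * b * (a + b) * b = b ^ 4 + (a ^ 2 + a * b + b ^ 2) * b ^ 2
    linear_combination (-b ^ 4) * two_eq_zero

/-- The extreme components of the total square of a polynomial `f` of degree `d`: the bottom ones
are `f` and `Sq¹ f`, the top one is `f²`, and the one just below the top, `Sq^{d-1} f`, is
determined by `v Sq^{d-1} f = (Sq¹ f)² + d u f²`. -/
theorem homogeneousComponent_totalSqPoly {f : Poly} {d : ℕ} (hf : f.IsHomogeneous d) :
    (∀ k < d, homogeneousComponent k (totalSqPoly f) = 0) ∧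
    homogeneousComponent d (totalSqPoly f) = f ∧
    homogeneousComponent (d + 1) (totalSqPoly f) = sqOneDer f ∧
    (∀ k, 2 * d < k → homogeneousComponent k (totalSqPoly f) = 0) ∧
    homogeneousComponent (2 * d) (totalSqPoly f) = f ^ 2 ∧
    (∀ k, k + 1 = 2 * d → (v : Poly) * homogeneousComponent k (totalSqPoly f) =
      sqOneDer f ^ 2 + d * (u : Poly) * f ^ 2) := by
  have hsq : ∀ f g : Poly, (f + g) ^ 2 = f ^ 2 + g ^ 2 := fun f g => by
    linear_combination (f * g) * two_eq_zero
  refine homogeneous_induction (P := fun d f =>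
    (∀ k < d, homogeneousComponent k (totalSqPoly f) = 0) ∧
    homogeneousComponent d (totalSqPoly f) = f ∧
    homogeneousComponent (d + 1) (totalSqPoly f) = sqOneDer f ∧
    (∀ k, 2 * d < k → homogeneousComponent k (totalSqPoly f) = 0) ∧
    homogeneousComponent (2 * d) (totalSqPoly f) = f ^ 2 ∧
    (∀ k, k + 1 = 2 * d → (v : Poly) * homogeneousComponent k (totalSqPoly f) =
      sqOneDer f ^ 2 + d * (u : Poly) * f ^ 2)) ?_ ?_ ?_ ?_ hf
  · intro d
    simp
  · rintro d f g ⟨f1, f2, f3, f4, f5, f6⟩ ⟨g1, g2, g3, g4, g5, g6⟩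
    refine ⟨fun k hk => ?_, ?_, ?_, fun k hk => ?_, ?_, fun k hk => ?_⟩
    · rw [map_add, map_add, f1 k hk, g1 k hk, add_zero]
    · rw [map_add, map_add, f2, g2]
    · rw [map_add, map_add, f3, g3, map_add]
    · rw [map_add, map_add, f4 k hk, g4 k hk, add_zero]
    · rw [map_add, map_add, f5, g5, hsq]
    · rw [map_add, map_add, mul_add, f6 k hk, g6 k hk, map_add, hsq, hsq]
      ring
  · have h1 : ∀ k, k ≠ 0 → homogeneousComponent k (1 : Poly) = 0 := fun k hk => by
      rw [homogeneousComponent_of_mem (isHomogeneous_one _ _), if_neg hk]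
    have h0 : homogeneousComponent 0 (1 : Poly) = 1 :=
      homogeneousComponent_eq_self (isHomogeneous_one _ _)
    refine ⟨fun k hk => by omega, ?_, ?_, fun k hk => ?_, ?_, fun k hk => by omega⟩
    · rw [map_one, h0]
    · rw [map_one, h1 _ (by omega), Derivation.map_one_eq_zero]
    · rw [map_one, h1 _ (by omega)]
    · rw [map_one, mul_zero, h0, one_pow]
  · rintro d f i hf ⟨f1, f2, f3, f4, f5, f6⟩
    have hD : sqOneDer (X i * f) = X i * sqOneDer f + f * X i ^ 2 := by
      rw [Derivation.leibniz, sqOneDer_X]; rfl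
    refine ⟨fun k hk => ?_, ?_, ?_, fun k hk => ?_, ?_, fun k hk => ?_⟩ <;>
      rw [homogeneousComponent_totalSqPoly_X_mul]
    · split_ifs <;> (try rw [f1 (k - 1) (by omega)]) <;> (try rw [f1 (k - 2) (by omega)]) <;> simp
    · rw [if_pos (by omega), Nat.add_sub_cancel, f2]
      split_ifs
      · rw [f1 _ (by omega)]; ring
      · ring
    · rw [if_pos (by omega), if_pos (by omega), Nat.add_sub_cancel,
        show d + 1 + 1 - 2 = d by omega, f3, f2, hD]
      ring
    · rw [if_pos (by omega), if_pos (by omega), f4 _ (by omega), f4 _ (by omega)]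
      simp
    · rw [if_pos (by omega), if_pos (by omega), f4 _ (by omega),
        show 2 * (d + 1) - 2 = 2 * d by omega, f5]
      ring
    · rw [if_pos (by omega), show k - 1 = 2 * d by omega, f5, hD]
      rcases Nat.eq_zero_or_pos d with rfl | hd
      · rw [if_neg (by omega)]
        have hDf : sqOneDer f = 0 := by rw [← f3, f4 _ (by omega)]
        rw [hDf]
        push_cast
        linear_combination f ^ 2 * coe_v_mul_X i
      · have h6 := f6 (k - 2) (by omega)
        rw [if_pos (by omega)]
        push_cast
        linear_combination f ^ 2 * coe_v_mul_X i + X i ^ 2 * h6 -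
          (X i * sqOneDer f * f * X i ^ 2) * two_eq_zero

theorem coe_sq_one (f : H) : (sq 1 f : Poly) = sqOneDer (f : Poly) := by
  change sqPoly 1 (f : Poly) = _
  conv_rhs => rw [← sum_homogeneousComponent (f : Poly), map_sum]
  refine Finset.sum_congr rfl fun n _ => ?_
  exact (homogeneousComponent_totalSqPoly (homogeneousComponent_isHomogeneous n _)).2.2.1

theorem coe_totalSq (f : H) : (totalSq f : Poly) = totalSqPoly (f : Poly) := rfl

theorem comp_totalSq_succ {f : H} {d : ℕ} (hf : (f : Poly).IsHomogeneous d) :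
    comp (d + 1) (totalSq f) = sq 1 f := by
  apply Subtype.ext
  rw [coe_comp, coe_sq_one, coe_totalSq]
  exact (homogeneousComponent_totalSqPoly hf).2.2.1

theorem sq_one_isHomogeneous {f : H} {d : ℕ} (hf : (f : Poly).IsHomogeneous d) :
    (sq 1 f : Poly).IsHomogeneous (d + 1) := by
  rw [← comp_totalSq_succ hf]
  exact comp_isHomogeneous _ _

theorem v_mul_comp_totalSq {f : H} {d k : ℕ} (hf : (f : Poly).IsHomogeneous d)
    (hk : k + 1 = 2 * d) :
    v * comp k (totalSq f) = sq 1 f ^ 2 + d * u * f ^ 2 := by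
  apply Subtype.ext
  have := (homogeneousComponent_totalSqPoly hf).2.2.2.2.2 k hk
  rw [← coe_sq_one, ← coe_totalSq, ← coe_comp] at this
  exact this

instance : CharP H 2 := charP_of_injective_algebraMap (algebraMap (ZMod 2) H).injective 2

theorem two_eq_zero' : (2 : H) = 0 := CharTwo.two_eq_zero

theorem sq_one_mul (f g : H) : sq 1 (f * g) = f * sq 1 g + g * sq 1 f := by
  apply Subtype.ext
  change (sq 1 (f * g) : Poly) = (f : Poly) * (sq 1 g : Poly) + g * (sq 1 f : Poly)
  simp only [coe_sq_one]
  exact Derivation.leibniz _ _ _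

theorem sq_one_add (f g : H) : sq 1 (f + g) = sq 1 f + sq 1 g := by
  apply Subtype.ext
  change (sq 1 (f + g) : Poly) = (sq 1 f : Poly) + (sq 1 g : Poly)
  simp only [coe_sq_one]
  exact map_add _ _ _

theorem sq_one_sq (f : H) : sq 1 (f ^ 2) = 0 := by
  rw [pow_two, sq_one_mul]
  linear_combination (f * sq 1 f) * two_eq_zero'

theorem sq_one_sq_one (f : H) : sq 1 (sq 1 f) = 0 := by
  apply Subtype.ext
  rw [coe_sq_one, coe_sq_one]
  change _ = (0 : Poly)
  induction (f : Poly) using MvPolynomial.induction_on with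
  | C c => simp [← MvPolynomial.algebraMap_eq]
  | add p q hp hq => rw [map_add, map_add, hp, hq, add_zero]
  | mul_X p i hp =>
    simp only [Derivation.leibniz, map_add, smul_eq_mul, Derivation.leibniz_pow, sqOneDer_X, hp]
    simp only [nsmul_eq_mul]
    push_cast
    linear_combination (X i ^ 2 * sqOneDer p + p * X i * X i ^ 2) * two_eq_zero

theorem sq_one_u : sq 1 u = v := by
  apply Subtype.ext
  rw [coe_sq_one, coe_u, coe_v]
  have ha : sqOneDer a = a ^ 2 := sqOneDer_X 0
  have hb : sqOneDer b = b ^ 2 := sqOneDer_X 1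
  simp only [map_add, Derivation.leibniz, Derivation.leibniz_pow, smul_eq_mul, nsmul_eq_mul, ha, hb]
  push_cast
  linear_combination (a ^ 3 + b ^ 3) * two_eq_zero

/-- The total Dickson class `1 + u + v`, by which the total Steenrod square multiplies `v`. -/
def dickson : H := 1 + u + v

theorem totalSq_u : totalSq u = u + v + u ^ 2 := by
  apply Subtype.ext
  rw [coe_totalSq]
  change totalSqPoly (u : Poly) = (u : Poly) + (v : Poly) + (u : Poly) ^ 2
  rw [coe_u, coe_v]
  simp only [map_add, map_mul, map_pow, totalSqPoly_a, totalSqPoly_b]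
  linear_combination (a ^ 3 + b ^ 3 - a ^ 3 * b - a * b ^ 3 - a ^ 2 * b ^ 2) * two_eq_zero

theorem totalSq_v : totalSq v = v * dickson := by
  apply Subtype.ext
  rw [coe_totalSq]
  change totalSqPoly (v : Poly) = (v : Poly) * (1 + (u : Poly) + (v : Poly))
  rw [coe_u, coe_v]
  simp only [map_add, map_mul, totalSqPoly_a, totalSqPoly_b]
  linear_combination (a * b ^ 3 + a ^ 2 * b ^ 2 + a ^ 3 * b - a ^ 3 * b ^ 3) * two_eq_zero

theorem x_zero : x 0 = 1 := rfl

theorem x_one : x 1 = u := rfl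

theorem sq_one_x_succ (n : ℕ) : sq 1 (x (n + 1)) = v * x n ^ 2 := by
  cases n with
  | zero => rw [x_one, x_zero, sq_one_u]; ring
  | succ n =>
    change sq 1 (u * x (n + 1) ^ 2 + sq 1 (x (n + 1)) ^ 2) = _
    rw [sq_one_add, sq_one_mul, sq_one_sq, sq_one_sq, sq_one_u]
    ring

theorem x_add_two (n : ℕ) : x (n + 2) = u * x (n + 1) ^ 2 + v ^ 2 * x n ^ 4 := by
  change u * x (n + 1) ^ 2 + sq 1 (x (n + 1)) ^ 2 = _
  rw [sq_one_x_succ]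
  ring

theorem x_isHomogeneous (n : ℕ) : (x n : Poly).IsHomogeneous (2 ^ (n + 1) - 2) := by
  induction n using Nat.strong_induction_on with
  | _ n ih =>
    match n with
    | 0 => exact isHomogeneous_one _ _
    | 1 => exact isHomogeneous_u
    | n + 2 =>
      have h1 := ih (n + 1) (by omega)
      have h0 := ih n (by omega)
      rw [x_add_two]
      have hn : 2 ≤ 2 ^ (n + 1) := by
        rw [pow_succ]; have := Nat.one_le_two_pow (n := n); omega
      have e1 : 2 ^ (n + 2 + 1) - 2 = 2 + (2 ^ (n + 1 + 1) - 2) * 2 := by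
        rw [pow_succ, pow_succ] ; omega
      have e2 : 2 ^ (n + 2 + 1) - 2 = 3 * 2 + (2 ^ (n + 1) - 2) * 4 := by
        rw [pow_succ, pow_succ] ; omega
      refine IsHomogeneous.add (φ := ((u * x (n + 1) ^ 2 : H) : Poly))
        (ψ := ((v ^ 2 * x n ^ 4 : H) : Poly)) ?_ ?_
      · rw [e1]; exact isHomogeneous_u.mul (h1.pow 2)
      · rw [e2]; exact (isHomogeneous_v.pow 2).mul (h0.pow 4)

theorem res_x (n : ℕ) : res (x n) = Polynomial.X ^ (2 ^ (n + 1) - 2) := by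
  induction n with
  | zero => simp [x_zero]
  | succ n ih =>
    cases n with
    | zero => simp [x_one]
    | succ n =>
      rw [x_add_two, map_add, map_mul, map_mul, map_pow, map_pow, map_pow, ih, res_u, res_v]
      have hn : 2 ≤ 2 ^ (n + 1) := by
        rw [pow_succ]; have := Nat.one_le_two_pow (n := n); omega
      rw [zero_pow two_ne_zero, zero_mul, add_zero, ← pow_mul, ← pow_add]
      congr 1
      rw [pow_succ 2 (n + 1 + 1), pow_succ 2 (n + 1)]
      omega

theorem dickson_ne_zero : dickson ≠ 0 := by
  intro h
  have := congrArg (fun f => (res f).coeff 0) h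
  simp [dickson] at this

/-- The total square of `x_{n+1}`, together with the square of that of `x_n`. -/
theorem dickson_mul_totalSq_x (n : ℕ) :
    dickson ^ 2 * totalSq (x n) ^ 2 =
      x n ^ 2 * (1 + u + v ^ 2 * x n ^ 2) + x (n + 1) + x (n + 1) ^ 2 ∧
    dickson * totalSq (x (n + 1)) =
      x (n + 1) + v * x n ^ 2 + x (n + 2) + v * x (n + 1) ^ 2 := by
  induction n with
  | zero =>
    rw [x_add_two, zero_add, x_one, x_zero, map_one, totalSq_u]
    unfold dickson
    constructor
    · linear_combination (v + u * v) * two_eq_zero'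
    · linear_combination (u ^ 2 + u * v) * two_eq_zero'
  | succ n ih =>
    obtain ⟨hA, hB⟩ := ih
    have h := x_add_two n
    have hA' : dickson ^ 2 * totalSq (x (n + 1)) ^ 2 =
        x (n + 1) ^ 2 * (1 + u + v ^ 2 * x (n + 1) ^ 2) + x (n + 2) + x (n + 2) ^ 2 := by
      rw [← mul_pow, hB]
      generalize x (n + 1) = p, x (n + 2) = q, x n = r at h
      linear_combination (p * v * r ^ 2 + p * q + p * v * p ^ 2 + v * r ^ 2 * q +
        v * r ^ 2 * v * p ^ 2 + q * v * p ^ 2 - u * p ^ 2) * two_eq_zero' - h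
    refine ⟨hA', ?_⟩
    apply mul_left_cancel₀ dickson_ne_zero
    have e : dickson * (dickson * totalSq (x (n + 1 + 1))) =
        (u + v + u ^ 2) * (dickson ^ 2 * totalSq (x (n + 1)) ^ 2) +
        v ^ 2 * (dickson ^ 2 * totalSq (x n) ^ 2) ^ 2 := by
      rw [x_add_two, map_add, map_mul, map_mul, map_pow, map_pow, map_pow, totalSq_u, totalSq_v]
      ring
    rw [e, hA', hA, x_add_two (n + 1), h]
    unfold dickson
    generalize x (n + 1) = p, x n = r
    linear_combination (p * r ^ 2 * u * v ^ 2 + p * r ^ 2 * v ^ 2 + p * r ^ 4 * v ^ 4 +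
      p ^ 2 * r ^ 2 * u * v ^ 2 + p ^ 2 * r ^ 2 * v ^ 2 - p ^ 2 * r ^ 4 * u * v ^ 4 -
      2 * p ^ 2 * r ^ 4 * u ^ 2 * v ^ 3 + p ^ 2 * r ^ 4 * v ^ 4 + p ^ 2 * u ^ 2 + p ^ 2 * u ^ 3 +
      p ^ 3 * v ^ 2 - p ^ 4 * u ^ 3 * v + r ^ 4 * u * v ^ 2 + r ^ 4 * u ^ 2 * v ^ 2 +
      r ^ 6 * u * v ^ 4 + r ^ 6 * v ^ 4 - r ^ 8 * u * v ^ 5) * two_eq_zero'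

theorem res_totalSq (f : H) :
    res (totalSq f) = Polynomial.aeval (Polynomial.X + Polynomial.X ^ 2) (res f) := by
  have h : restrict.comp totalSqPoly =
      (Polynomial.aeval (Polynomial.X + Polynomial.X ^ 2)).comp restrict := by
    apply MvPolynomial.algHom_ext
    intro i
    fin_cases i
    · change restrict (totalSqPoly a) = Polynomial.aeval _ (restrict a)
      simp
    · change restrict (totalSqPoly b) = Polynomial.aeval _ (restrict b)
      simp
  exact DFunLike.congr_fun h (f : Poly)

theorem res_totalSq_of_eq {f : H} {d : ℕ} (hf : res f = Polynomial.X ^ d) :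
    res (totalSq f) = Polynomial.X ^ d * (1 + Polynomial.X) ^ d := by
  rw [res_totalSq, hf, map_pow, Polynomial.aeval_X, ← mul_pow]
  ring

/-! ### Ideals generated by two homogeneous invariants -/

theorem comp_mem_span {X Y f : H} {p q : ℕ} (hX : (X : Poly).IsHomogeneous p)
    (hY : (Y : Poly).IsHomogeneous q) (hf : f ∈ Ideal.span {X, Y}) (n : ℕ) :
    comp n f ∈ Ideal.span {X, Y} := by
  obtain ⟨c, d, rfl⟩ := Ideal.mem_span_pair.1 hf
  rw [map_add, comp_mul hX, comp_mul hY]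
  refine add_mem ?_ ?_ <;> split_ifs <;>
    first
    | exact zero_mem _
    | exact Ideal.mul_mem_left _ _ (Ideal.subset_span (by simp))

theorem exists_homogeneous_coeffs {X Y f : H} {p q n : ℕ} (hX : (X : Poly).IsHomogeneous p)
    (hY : (Y : Poly).IsHomogeneous q) (hf : f ∈ Ideal.span {X, Y})
    (hn : (f : Poly).IsHomogeneous n) :
    ∃ c d : H, f = c * X + d * Y ∧
      (n < p → c = 0) ∧ (∀ k, k + p = n → (c : Poly).IsHomogeneous k) ∧
      (n < q → d = 0) ∧ (∀ k, k + q = n → (d : Poly).IsHomogeneous k) := by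
  obtain ⟨c, d, h⟩ := Ideal.mem_span_pair.1 hf
  refine ⟨if p ≤ n then comp (n - p) c else 0, if q ≤ n then comp (n - q) d else 0,
    ?_, fun h => by rw [if_neg (by omega)], fun k hk => ?_, fun h => by rw [if_neg (by omega)],
    fun k hk => ?_⟩
  · have := comp_eq_self hn
    rw [← h, map_add, comp_mul hX, comp_mul hY] at this
    rw [← h, ← this]
    split_ifs <;> simp
  · rw [if_pos (by omega), show n - p = k by omega]
    exact comp_isHomogeneous _ _
  · rw [if_pos (by omega), show n - q = k by omega]
    exact comp_isHomogeneous _ _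

theorem eq_zero_or_one_of_isHomogeneous_zero {f : H} (hf : (f : Poly).IsHomogeneous 0) :
    f = 0 ∨ f = 1 := by
  have h := totalDegree_eq_zero_iff_eq_C.1 ((totalDegree_zero_iff_isHomogeneous _).2 hf)
  have hc : ∀ c : ZMod 2, c = 0 ∨ c = 1 := by decide
  rcases hc (coeff 0 (f : Poly)) with h0 | h0 <;> rw [h0] at h
  · left; apply Subtype.ext; rw [h]; simp
  · right; apply Subtype.ext; rw [h]; simp

/-- The radical of the ideal contains `u` and `v`. For an ideal generated by homogeneous elements
this says that the quotient is finite-dimensional. -/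
def FullRadical (I : Ideal H) : Prop := u ∈ I.radical ∧ v ∈ I.radical

theorem FullRadical.mono {I J : Ideal H} (h : FullRadical I) (hIJ : I ≤ J) : FullRadical J :=
  ⟨Ideal.radical_mono hIJ h.1, Ideal.radical_mono hIJ h.2⟩

theorem FullRadical.of_finite {X Y : H} {p q : ℕ} (hX : (X : Poly).IsHomogeneous p)
    (hY : (Y : Poly).IsHomogeneous q) (hfin : Module.Finite (ZMod 2) (H ⧸ Ideal.span {X, Y})) :
    FullRadical (Ideal.span {X, Y}) := by
  have : Finite (H ⧸ Ideal.span {X, Y}) := Module.finite_of_finite (ZMod 2)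
  have key : ∀ (z : H) (d : ℕ), 0 < d → (z : Poly).IsHomogeneous d →
      z ∈ (Ideal.span {X, Y}).radical := by
    intro z d hd hz
    have hz' : ∀ n, ((z ^ n : H) : Poly).IsHomogeneous (d * n) := fun n => hz.pow n
    obtain ⟨i, j, hij, h⟩ := Finite.exists_ne_map_eq_of_infinite
      (fun n : ℕ => Ideal.Quotient.mk (Ideal.span {X, Y}) (z ^ n))
    have hm := comp_mem_span hX hY (Ideal.Quotient.eq.1 h) (d * i)
    rw [map_sub, comp_eq_self (hz' i), comp_eq_zero (hz' j), sub_zero] at hm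
    · exact ⟨i, hm⟩
    · intro he
      exact hij (Nat.eq_of_mul_eq_mul_left hd he)
  exact ⟨key u 2 (by norm_num) isHomogeneous_u, key v 3 (by norm_num) isHomogeneous_v⟩

/-- The transfer `1 + rot + rot²` from polynomials to invariants. It is the identity on invariants,
because `3 = 1`. -/
def transfer (f : Poly) : H := ⟨f + rot f + rot (rot f), by
  rw [mem_iff, map_add, map_add, rot_rot_rot]; ring⟩

theorem transfer_mul_coe (f : Poly) (g : H) : transfer (f * g) = transfer f * g := by
  apply Subtype.ext
  change f * g + rot (f * g) + rot (rot (f * g)) = (f + rot f + rot (rot f)) * g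
  have h : rot (g : Poly) = g := (mem_iff _).1 g.2
  rw [map_mul, map_mul, h, h]
  ring

theorem transfer_coe (g : H) : transfer (g : Poly) = g := by
  apply Subtype.ext
  change (g : Poly) + rot g + rot (rot g) = g
  have h : rot (g : Poly) = g := (mem_iff _).1 g.2
  rw [h, h]
  linear_combination (g : Poly) * two_eq_zero

theorem transfer_add (f g : Poly) : transfer (f + g) = transfer f + transfer g := by
  apply Subtype.ext
  change f + g + rot (f + g) + rot (rot (f + g)) =
    (f + rot f + rot (rot f)) + (g + rot g + rot (rot g))
  simp only [map_add]
  ring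

theorem mem_of_coe_mem_map {I : Ideal H} {f : H}
    (hf : (f : Poly) ∈ I.map (algebraMap H Poly)) : f ∈ I := by
  have key : ∀ g ∈ I.map (algebraMap H Poly), ∀ s : Poly, transfer (s * g) ∈ I := by
    intro g hg
    refine Submodule.span_induction ?_ ?_ ?_ ?_ hg
    · rintro _ ⟨i, hi, rfl⟩ s
      change transfer (s * (i : Poly)) ∈ I
      rw [transfer_mul_coe]
      exact I.mul_mem_left _ hi
    · intro s
      have h0 : transfer (s * 0) = 0 := by
        rw [mul_zero]
        exact transfer_coe 0
      rw [h0]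
      exact zero_mem _
    · intro x y _ _ hx hy s
      rw [mul_add, transfer_add]
      exact add_mem (hx s) (hy s)
    · intro r x _ hx s
      rw [smul_eq_mul, ← mul_assoc]
      exact hx _
  have := key _ hf 1
  rwa [one_mul, transfer_coe] at this

theorem FullRadical.finite {I : Ideal H} (hI : FullRadical I) :
    Module.Finite (ZMod 2) (H ⧸ I) := by
  set J : Ideal Poly := I.map (algebraMap H Poly)
  have hnil : ∀ z ∈ I.radical, IsNilpotent (Ideal.Quotient.mk J (z : Poly)) := by
    rintro z ⟨n, hn⟩
    refine ⟨n, ?_⟩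
    rw [← map_pow, Ideal.Quotient.eq_zero_iff_mem]
    exact Ideal.mem_map_of_mem (algebraMap H Poly) hn
  have hX : ∀ i : Fin 2, IsIntegral (ZMod 2) (Ideal.Quotient.mk J (X i)) := by
    intro i
    have h4 : IsNilpotent (Ideal.Quotient.mk J (X i) ^ 4) := by
      have e : (X i : Poly) ^ 4 = (v : Poly) * X i - (u : Poly) * X i ^ 2 := by
        rw [coe_v_mul_X]; ring
      rw [← map_pow, e, map_sub, map_mul, map_mul]
      exact (Commute.all _ _).isNilpotent_sub
        ((Commute.all _ _).isNilpotent_mul_right (hnil v hI.2))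
        ((Commute.all _ _).isNilpotent_mul_right (hnil u hI.1))
    obtain ⟨n, hn⟩ := h4
    refine IsIntegral.of_pow (n := 4 * (n + 1)) (by omega) ?_
    rw [pow_mul, pow_succ, hn, zero_mul]
    exact isIntegral_zero
  have hint : Algebra.IsIntegral (ZMod 2) (Poly ⧸ J) := by
    constructor
    intro z
    obtain ⟨f, rfl⟩ := Ideal.Quotient.mk_surjective z
    induction f using MvPolynomial.induction_on with
    | C c =>
      rw [← MvPolynomial.algebraMap_eq]
      exact isIntegral_algebraMap (R := ZMod 2) (A := Poly ⧸ J) (x := c)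
    | add f g hf hg => rw [map_add]; exact hf.add hg
    | mul_X f i hf => rw [map_mul]; exact hf.mul (hX i)
  have hfin : Module.Finite (ZMod 2) (Poly ⧸ J) := Algebra.IsIntegral.finite
  let φ : (H ⧸ I) →ₐ[ZMod 2] (Poly ⧸ J) :=
    Ideal.quotientMapₐ J (Subalgebra.val _) Ideal.le_comap_map
  refine Module.Finite.of_injective φ.toLinearMap ?_
  rw [← LinearMap.ker_eq_bot, LinearMap.ker_eq_bot']
  intro z hz
  obtain ⟨f, rfl⟩ := Ideal.Quotient.mk_surjective z
  have hz' : Ideal.Quotient.mk J (f : Poly) = 0 := hz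
  rw [Ideal.Quotient.eq_zero_iff_mem] at hz' ⊢
  exact mem_of_coe_mem_map hz'

theorem FullRadical.isRelPrime {X Y : H} (h : FullRadical (Ideal.span {X, Y})) :
    IsRelPrime (X : Poly) (Y : Poly) := by
  intro d hX hY
  have key : ∀ z ∈ (Ideal.span {X, Y}).radical, ∃ n, d ∣ (z : Poly) ^ n := by
    rintro z ⟨n, hn⟩
    obtain ⟨α, β, hαβ⟩ := Ideal.mem_span_pair.1 hn
    refine ⟨n, ?_⟩
    have : (z : Poly) ^ n = α * X + β * Y := by
      have := congrArg (Subtype.val) hαβ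
      exact this.symm
    rw [this]
    exact dvd_add (hX.mul_left _) (hY.mul_left _)
  obtain ⟨n, hn⟩ := key _ h.1
  obtain ⟨m, hm⟩ := key _ h.2
  exact (isRelPrime_v_u.pow (m := m) (n := n)) hm hn

theorem not_fullRadical_of_res_eq_zero {X Y : H} (hX : res X = 0) (hY : res Y = 0) :
    ¬ FullRadical (Ideal.span {X, Y}) := by
  rintro ⟨⟨n, hn⟩, -⟩
  obtain ⟨α, β, hαβ⟩ := Ideal.mem_span_pair.1 hn
  have := congrArg res hαβ
  rw [map_add, map_mul, map_mul, hX, hY, map_pow, res_u, mul_zero, mul_zero, add_zero] at this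
  exact pow_ne_zero _ (pow_ne_zero _ Polynomial.X_ne_zero) this.symm

theorem not_isUnit_of_isHomogeneous {Y : H} {q : ℕ} (hY : (Y : Poly).IsHomogeneous q)
    (hq : 0 < q) : ¬ IsUnit (Y : Poly) := by
  intro hu
  have h0 := hu.map (constantCoeff (R := ZMod 2) (σ := Fin 2))
  have hz : coeff 0 (Y : Poly) = 0 := hY.coeff_eq_zero (by simp; omega)
  rw [constantCoeff_eq, hz] at h0
  exact not_isUnit_zero h0

theorem ne_zero_of_isRelPrime {X Y : H} {q : ℕ} (h : IsRelPrime (X : Poly) (Y : Poly))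
    (hY : (Y : Poly).IsHomogeneous q) (hq : 0 < q) : X ≠ 0 := by
  rintro rfl
  exact not_isUnit_of_isHomogeneous hY hq (isRelPrime_zero_left.1 h)

theorem FullRadical.notMem_span_singleton {X Y : H} {p : ℕ}
    (h : FullRadical (Ideal.span {X, Y})) (hX : (X : Poly).IsHomogeneous p) (hp : 0 < p) :
    Y ∉ Ideal.span {X} := by
  intro hY
  obtain ⟨c, rfl⟩ := Ideal.mem_span_singleton.1 hY
  exact not_isUnit_of_isHomogeneous hX hp (h.isRelPrime.isUnit_of_dvd ⟨(c : Poly), rfl⟩)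

/-- Modulo an ideal with full radical, the total Dickson class is a unit, because its `2^n`-th
power is `1 + u^{2^n} + v^{2^n}`. -/
theorem FullRadical.mem_of_dickson_pow_mul_mem {K : Ideal H} (hK : FullRadical K) {g : H} {n : ℕ}
    (hg : dickson ^ n * g ∈ K) : g ∈ K := by
  obtain ⟨⟨i, hi⟩, ⟨j, hj⟩⟩ := hK
  set r := i + j + n
  have hr : r < 2 ^ r := Nat.lt_two_pow_self
  have e : dickson ^ 2 ^ r = 1 + u ^ 2 ^ r + v ^ 2 ^ r := by
    rw [dickson, add_pow_char_pow, add_pow_char_pow, one_pow]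
  have hu : u ^ 2 ^ r ∈ K := K.pow_mem_of_pow_mem hi (by omega)
  have hv : v ^ 2 ^ r ∈ K := K.pow_mem_of_pow_mem hj (by omega)
  have h1 : dickson ^ 2 ^ r * g ∈ K := by
    have : dickson ^ 2 ^ r = dickson ^ (2 ^ r - n) * dickson ^ n := by
      rw [← pow_add]; congr 1; omega
    rw [this, mul_assoc]
    exact K.mul_mem_left _ hg
  rw [e] at h1
  have h2 : g = (1 + u ^ 2 ^ r + v ^ 2 ^ r) * g - g * u ^ 2 ^ r - g * v ^ 2 ^ r := by ring
  rw [h2]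
  exact sub_mem (sub_mem h1 (K.mul_mem_left _ hu)) (K.mul_mem_left _ hv)

theorem isSteenrodClosed_span_pair {X Y : H} (hX : totalSq X ∈ Ideal.span {X, Y})
    (hY : totalSq Y ∈ Ideal.span {X, Y}) : IsSteenrodClosed (Ideal.span {X, Y}) := by
  intro f hf
  obtain ⟨c, d, rfl⟩ := Ideal.mem_span_pair.1 hf
  rw [map_add, map_mul, map_mul]
  exact add_mem (Ideal.mul_mem_left _ _ hX) (Ideal.mul_mem_left _ _ hY)

/-- Two homogeneous generators of distinct degrees of an ideal are determined by the ideal, up to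
adding a multiple of the one of lower degree to the other. -/
theorem generators_of_span_eq {C D X Y : H} {c d p q : ℕ} (hC : (C : Poly).IsHomogeneous c)
    (hD : (D : Poly).IsHomogeneous d) (hcd : c < d) (hX : (X : Poly).IsHomogeneous p)
    (hY : (Y : Poly).IsHomogeneous q) (hC0 : C ≠ 0) (hDC : D ∉ Ideal.span {C})
    (h : Ideal.span {C, D} = Ideal.span {X, Y}) :
    (p = c ∧ q = d ∧ X = C ∧ ∃ e : H, (e : Poly).IsHomogeneous (d - c) ∧ Y = D + e * C) ∨
      (p = d ∧ q = c ∧ Y = C ∧ ∃ e : H, (e : Poly).IsHomogeneous (d - c) ∧ X = D + e * C) := by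
  -- the case in which the degrees of `X` and `Y` are in order
  have aux : ∀ {X Y : H} {p q : ℕ}, (X : Poly).IsHomogeneous p → (Y : Poly).IsHomogeneous q →
      Ideal.span {C, D} = Ideal.span {X, Y} → p ≤ q →
      p = c ∧ q = d ∧ X = C ∧ ∃ e : H, (e : Poly).IsHomogeneous (d - c) ∧ Y = D + e * C := by
    intro X Y p q hX hY h hpq
    have hCm : C ∈ Ideal.span {X, Y} := by rw [← h]; exact Ideal.subset_span (by simp)
    have hDm : D ∈ Ideal.span {X, Y} := by rw [← h]; exact Ideal.subset_span (by simp)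
    have hXm : X ∈ Ideal.span {C, D} := by rw [h]; exact Ideal.subset_span (by simp)
    have hYm : Y ∈ Ideal.span {C, D} := by rw [h]; exact Ideal.subset_span (by simp)
    -- elements of the ideal of degree below `d` are multiples of `C`
    have low : ∀ {Z : H} {n : ℕ}, (Z : Poly).IsHomogeneous n → Z ∈ Ideal.span {C, D} → n < d →
        ∃ e : H, Z = e * C ∧ (n < c → e = 0) ∧ (n = c → e = 0 ∨ e = 1) := by
      intro Z n hZ hZm hn
      obtain ⟨α, β, h1, h2, h3, h4, -⟩ := exists_homogeneous_coeffs hC hD hZm hZ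
      refine ⟨α, ?_, h2, fun hnc => ?_⟩
      · rw [h1, h4 hn, zero_mul, add_zero]
      · exact eq_zero_or_one_of_isHomogeneous_zero (h3 0 (by omega))
    have hspan : ∀ e f : H, X = e * C → Y = f * C → False := by
      intro e f hXe hYf
      obtain ⟨α, β, hαβ⟩ := Ideal.mem_span_pair.1 hDm
      apply hDC
      rw [← hαβ, hXe, hYf, Ideal.mem_span_singleton]
      exact ⟨α * e + β * f, by ring⟩
    have hpc : p ≤ c := by
      by_contra hlt
      obtain ⟨α, β, h1, h2, -, h4, -⟩ := exists_homogeneous_coeffs hX hY hCm hC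
      rw [h2 (by omega), h4 (by omega)] at h1
      exact hC0 (by rw [h1]; ring)
    obtain ⟨e, hXe, he1, he2⟩ := low hX hXm (by omega)
    have hqd : d ≤ q := by
      by_contra hlt
      obtain ⟨f, hf, -⟩ := low hY hYm (by omega)
      exact hspan e f hXe hf
    have hXC : p = c ∧ X = C := by
      rcases Nat.lt_or_eq_of_le hpc with hlt | heq
      · exfalso
        have hX0 : X = 0 := by rw [hXe, he1 hlt, zero_mul]
        obtain ⟨α, β, h1, -, -, h4, -⟩ := exists_homogeneous_coeffs hX hY hCm hC
        rw [h4 (by omega), hX0] at h1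
        exact hC0 (by rw [h1]; ring)
      · refine ⟨heq, ?_⟩
        rcases he2 heq with he | he
        · exfalso
          have hX0 : X = 0 := by rw [hXe, he, zero_mul]
          obtain ⟨α, β, h1, -, -, h4, -⟩ := exists_homogeneous_coeffs hX hY hCm hC
          rw [h4 (by omega), hX0] at h1
          exact hC0 (by rw [h1]; ring)
        · rw [hXe, he, one_mul]
    obtain ⟨hpc', rfl⟩ := hXC
    obtain ⟨α, β, h1, -, h3, h4, h5⟩ := exists_homogeneous_coeffs hX hY hDm hD
    have hβ : β ≠ 0 := by
      rintro rfl
      apply hDC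
      rw [h1, Ideal.mem_span_singleton]
      exact ⟨α, by ring⟩
    have hqd' : q = d := by
      by_contra hne
      exact hβ (h4 (by omega))
    have hβ1 := (eq_zero_or_one_of_isHomogeneous_zero (h5 0 (by omega))).resolve_left hβ
    refine ⟨hpc', hqd', rfl, α, h3 _ (by omega), ?_⟩
    rw [h1, hβ1]
    linear_combination (- α * X) * two_eq_zero'
  rcases le_total p q with hpq | hpq
  · exact Or.inl (aux hX hY h hpq)
  · right
    obtain ⟨h1, h2, h3⟩ := aux hY hX (by rw [h, Set.pair_comm]) hpq
    exact ⟨h2, h1, h3⟩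

/-! ### Splitting off a factor `v` from a generator -/

theorem res_sq_one (f : H) :
    res (sq 1 f) = Polynomial.X ^ 2 * Polynomial.derivative (res f) := by
  rw [res_apply, res_apply, coe_sq_one]
  induction (f : Poly) using MvPolynomial.induction_on with
  | C c =>
    rw [← MvPolynomial.algebraMap_eq, Derivation.map_algebraMap, map_zero, AlgHom.commutes]
    simp
  | add p q hp hq => simp only [map_add, hp, hq, mul_add]
  | mul_X p i hp =>
    rw [Derivation.leibniz, smul_eq_mul, smul_eq_mul, map_add, map_mul, map_mul, map_mul, hp,
      sqOneDer_X, Polynomial.derivative_mul, map_pow]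
    have hi : restrict (X i) = 0 ∨ restrict (X i) = Polynomial.X := by
      fin_cases i
      · exact Or.inl restrict_a
      · exact Or.inr restrict_b
    rcases hi with hi | hi <;> rw [hi]
    · simp
    · rw [Polynomial.derivative_X]; ring

theorem natCast_eq_one_of_odd {R : Type*} [CommRing R] [CharP R 2] {n : ℕ} (hn : Odd n) :
    (n : R) = 1 := by
  obtain ⟨k, rfl⟩ := hn
  have h2 : (2 : R) = 0 := CharTwo.two_eq_zero
  push_cast
  linear_combination (k : R) * h2

theorem res_ne_zero {f : H} {d : ℕ} (hf : (f : Poly).IsHomogeneous d) (h : res f ≠ 0) :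
    res f = Polynomial.X ^ d :=
  (restrict_eq_zero_or hf).resolve_left h

/-- Two generators of consecutive degrees of a Steenrod closed parameter ideal cannot both be
nonzero modulo `v`. -/
theorem false_of_consecutive_degrees {X Y : H} {p : ℕ}
    (hcl : IsSteenrodClosed (Ideal.span {X, Y})) (hX : (X : Poly).IsHomogeneous p)
    (hY : (Y : Poly).IsHomogeneous (p + 1)) (hrel : IsRelPrime (X : Poly) (Y : Poly))
    (hX0 : res X ≠ 0) (hY0 : res Y ≠ 0) : False := by
  have hXne : X ≠ 0 := by rintro rfl; exact hX0 (map_zero _)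
  have hp1 : p ≠ 1 := by rintro rfl; exact hXne (eq_zero_of_isHomogeneous_one hX)
  have hXm : X ∈ Ideal.span {X, Y} := Ideal.subset_span (by simp)
  have hYm : Y ∈ Ideal.span {X, Y} := Ideal.subset_span (by simp)
  have hSX : sq 1 X ∈ Ideal.span {X, Y} := by
    rw [← comp_totalSq_succ hX]
    exact comp_mem_span hX hY (hcl X hXm) _
  have hSY : sq 1 Y ∈ Ideal.span {X, Y} := by
    rw [← comp_totalSq_succ hY]
    exact comp_mem_span hX hY (hcl Y hYm) _
  have hrX := res_ne_zero hX hX0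
  have hrY := res_ne_zero hY hY0
  -- as there is no invariant of degree one, `Sq¹ X` is a scalar multiple of `Y`
  obtain ⟨α, β, hXY, -, hα, -, hβ⟩ :=
    exists_homogeneous_coeffs hX hY hSX (sq_one_isHomogeneous hX)
  rw [eq_zero_of_isHomogeneous_one (hα 1 (by ring)), zero_mul, zero_add] at hXY
  have hβ := eq_zero_or_one_of_isHomogeneous_zero (hβ 0 (by ring))
  rcases Nat.even_or_odd p with hp | hp
  · -- if `p` is even, then `Sq¹ X = 0` and `Sq¹ Y = u X`, contrary to `Sq¹ Sq¹ = 0`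
    have hcast : ((p : ℕ) : Polynomial (ZMod 2)) = 0 :=
      (CharP.cast_eq_zero_iff _ 2 p).2 hp.two_dvd
    have hSX0 : sq 1 X = 0 := by
      rcases hβ with rfl | rfl
      · rw [hXY, zero_mul]
      · exfalso
        apply hY0
        rw [← one_mul Y, ← hXY, res_sq_one, hrX, Polynomial.derivative_X_pow]
        simp [hcast]
    obtain ⟨γ, δ, hγδ, -, hγ, -, hδ⟩ :=
      exists_homogeneous_coeffs hX hY hSY (sq_one_isHomogeneous hY)
    rw [eq_zero_of_isHomogeneous_one (hδ 1 (by ring)), zero_mul, add_zero] at hγδ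
    have hγ := hγ 2 (by ring)
    have hγ0 : res γ ≠ 0 := by
      intro h0
      have h1 := congrArg res hγδ
      rw [map_mul, h0, zero_mul, res_sq_one, hrY, Polynomial.derivative_X_pow] at h1
      simp [hcast] at h1
    have hγu : γ = u := by
      by_contra hne
      have hd : ((γ - u : H) : Poly).IsHomogeneous 2 := hγ.sub isHomogeneous_u
      obtain ⟨_, k, -, -, hk⟩ := exists_eq_v_mul hd
        (by rw [map_sub, res_ne_zero hγ hγ0, res_u, sub_self]) (sub_ne_zero.2 hne)
      omega
    have h2 := sq_one_sq_one Y
    rw [hγδ, sq_one_mul, hSX0, hγu, sq_one_u, mul_zero, zero_add] at h2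
    exact (mul_ne_zero hXne v_ne_zero) h2
  · -- if `p` is odd, then `Y = Sq¹ X`, and `Sq^{p-1} X` does not lie in the ideal
    have hcast : ((p : ℕ) : Polynomial (ZMod 2)) = 1 :=
      natCast_eq_one_of_odd hp
    have hcast' : ((p : ℕ) : H) = 1 :=
      natCast_eq_one_of_odd hp
    have hSXY : sq 1 X = Y := by
      rcases hβ with rfl | rfl
      · exfalso
        rw [zero_mul] at hXY
        have h1 := congrArg res hXY
        rw [map_zero, res_sq_one, hrX, Polynomial.derivative_X_pow] at h1
        simp [hcast] at h1
      · rw [hXY, one_mul]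
    have hp2 : 2 ≤ p := by
      rcases hp with ⟨k, rfl⟩
      omega
    obtain ⟨γ, δ, hγδ, -, -, -, hδ⟩ := exists_homogeneous_coeffs hX hY
      (comp_mem_span hX hY (hcl X hXm) (2 * p - 1)) (comp_isHomogeneous _ _)
    have hδ := hδ (p - 2) (by omega)
    have hv := v_mul_comp_totalSq (k := 2 * p - 1) hX (by omega)
    rw [hγδ, hSXY, hcast', one_mul] at hv
    have hdvd : X ∣ Y * (Y + v * δ) :=
      ⟨v * γ + u * X, by linear_combination hv + (Y ^ 2 - v * γ * X) * two_eq_zero'⟩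
    obtain ⟨ε, hε⟩ := dvd_of_dvd_mul hrel hdvd
    have hvδ : ((v * δ : H) : Poly).IsHomogeneous (p + 1) := by
      have := isHomogeneous_v.mul hδ
      rwa [show 3 + (p - 2) = p + 1 by omega] at this
    have hhom : ((Y + v * δ : H) : Poly).IsHomogeneous (p + 1) := hY.add hvδ
    have h1 := comp_eq_self hhom
    rw [hε, mul_comm X ε, comp_mul_of_add_eq hX (add_comm 1 p),
      eq_zero_of_isHomogeneous_one (comp_isHomogeneous 1 ε), zero_mul] at h1
    rw [mul_comm X ε, ← h1] at hε
    apply hY0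
    have h2 := congrArg res hε
    simpa using h2

/-- One of two homogeneous generators of a Steenrod closed parameter ideal can be chosen to be
divisible by `v`. -/
theorem exists_generators_v_mul {I : Ideal H} (hcl : IsSteenrodClosed I) (hfull : FullRadical I)
    {X Y : H} {p q : ℕ} (hX : (X : Poly).IsHomogeneous p) (hY : (Y : Poly).IsHomogeneous q)
    (hp : 0 < p) (hq : 0 < q) (hI : I = Ideal.span {X, Y}) :
    ∃ (A B : H) (m n : ℕ), (A : Poly).IsHomogeneous m ∧ (B : Poly).IsHomogeneous n ∧ 0 < m ∧
      m + n + 3 = p + q ∧ I = Ideal.span {A, v * B} := by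
  -- the case in which the degrees are in order
  have aux : ∀ {X Y : H} {p q : ℕ}, (X : Poly).IsHomogeneous p → (Y : Poly).IsHomogeneous q →
      0 < p → 0 < q → I = Ideal.span {X, Y} → p ≤ q →
      ∃ (A B : H) (m n : ℕ), (A : Poly).IsHomogeneous m ∧ (B : Poly).IsHomogeneous n ∧ 0 < m ∧
        m + n + 3 = p + q ∧ I = Ideal.span {A, v * B} := by
    intro X Y p q hX hY hp hq hI hpq
    subst hI
    have hrel := hfull.isRelPrime
    have hX0 : X ≠ 0 := ne_zero_of_isRelPrime hrel hY hq
    have hY0 : Y ≠ 0 := ne_zero_of_isRelPrime hrel.symm hX hp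
    by_cases hrX : res X = 0
    · obtain ⟨B, k, rfl, hB, hk⟩ := exists_eq_v_mul hX hrX hX0
      exact ⟨Y, B, q, k, hY, hB, hq, by omega, by rw [Set.pair_comm]⟩
    by_cases hrY : res Y = 0
    · obtain ⟨B, k, rfl, hB, hk⟩ := exists_eq_v_mul hY hrY hY0
      exact ⟨X, B, p, k, hX, hB, hp, by omega, rfl⟩
    have hne : q - p ≠ 1 := by
      intro h1
      obtain rfl : q = p + 1 := by omega
      exact false_of_consecutive_degrees hcl hX hY hrel hrX hrY
    obtain ⟨τ, hτ, hrτ⟩ := exists_res_eq_pow hne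
    have hspan : Ideal.span {X, Y} = Ideal.span {X, Y + τ * X} := by
      rw [Ideal.span_pair_add_mul_left]
    have hZ : ((Y + τ * X : H) : Poly).IsHomogeneous q := by
      refine hY.add ?_
      have := hτ.mul hX
      rwa [Nat.sub_add_cancel hpq] at this
    have hrZ : res (Y + τ * X) = 0 := by
      rw [map_add, map_mul, res_ne_zero hX hrX, res_ne_zero hY hrY, hrτ, ← pow_add,
        Nat.sub_add_cancel hpq, CharTwo.add_self_eq_zero]
    rw [hspan] at hfull
    have hZ0 : Y + τ * X ≠ 0 := ne_zero_of_isRelPrime hfull.isRelPrime.symm hX hp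
    obtain ⟨B, k, hB, hBh, hk⟩ := exists_eq_v_mul hZ hrZ hZ0
    exact ⟨X, B, p, k, hX, hBh, hp, by omega, by rw [hspan, hB]⟩
  rcases le_total p q with hpq | hpq
  · exact aux hX hY hp hq hI hpq
  · rw [add_comm p q]
    exact aux hY hX hq hp (by rw [hI, Set.pair_comm]) hpq

/-- The ideal `⟨A, B⟩` is the colon ideal of `⟨A, vB⟩` by `v`, and inherits closedness. -/
theorem isSteenrodClosed_of_v_mul {A B : H} (hcl : IsSteenrodClosed (Ideal.span {A, v * B}))
    (hfull : FullRadical (Ideal.span {A, v * B})) :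
    IsSteenrodClosed (Ideal.span {A, B}) ∧ FullRadical (Ideal.span {A, B}) := by
  have hle : Ideal.span {A, v * B} ≤ Ideal.span {A, B} := by
    rw [Ideal.span_le]
    rintro z (rfl | rfl)
    · exact Ideal.subset_span (by simp)
    · exact Ideal.mul_mem_left _ _ (Ideal.subset_span (by simp))
  have hfull' := hfull.mono hle
  refine ⟨fun f hf => ?_, hfull'⟩
  have hvA : IsRelPrime (A : Poly) (v : Poly) := by
    have := hfull.isRelPrime
    exact this.of_mul_right_left (y := (v : Poly)) (z := (B : Poly))
  have h1 : v * f ∈ Ideal.span {A, v * B} := by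
    obtain ⟨α, β, rfl⟩ := Ideal.mem_span_pair.1 hf
    exact Ideal.mem_span_pair.2 ⟨v * α, β, by ring⟩
  have h2 := hcl _ h1
  rw [map_mul, totalSq_v] at h2
  obtain ⟨α, β, h3⟩ := Ideal.mem_span_pair.1 h2
  obtain ⟨γ, hγ⟩ : v ∣ α := dvd_of_dvd_mul hvA.symm
    ⟨dickson * totalSq f - β * B, by linear_combination h3⟩
  apply hfull'.mem_of_dickson_pow_mul_mem (n := 1)
  refine Ideal.mem_span_pair.2 ⟨γ, β, ?_⟩
  apply mul_left_cancel₀ v_ne_zero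
  rw [hγ] at h3
  linear_combination h3

/-- The Steenrod closed parameter ideals that contain `v`. -/
theorem eq_span_of_v_mem {A : H} {m : ℕ} (hcl : IsSteenrodClosed (Ideal.span {A, v}))
    (hfull : FullRadical (Ideal.span {A, v})) (hA : (A : Poly).IsHomogeneous m) (hm : 0 < m) :
    ∃ l, 1 ≤ l ∧ Ideal.span {A, v} = Ideal.span {v, u ^ l} := by
  have hrA : res A ≠ 0 := fun h => not_fullRadical_of_res_eq_zero h res_v hfull
  have hr := res_ne_zero hA hrA
  rcases Nat.even_or_odd' m with ⟨l, rfl | rfl⟩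
  · refine ⟨l, by omega, ?_⟩
    obtain ⟨g, hg⟩ : v ∣ u ^ l - A := by
      rw [v_dvd_iff, map_sub, hr, map_pow, res_u, ← pow_mul, sub_self]
    have : u ^ l = A + g * v := by linear_combination hg
    rw [this, Ideal.span_pair_add_mul_left, Set.pair_comm]
  · exfalso
    obtain ⟨α, β, h⟩ := Ideal.mem_span_pair.1 (hcl A (Ideal.subset_span (by simp)))
    have h1 := congrArg res h
    rw [map_add, map_mul, map_mul, res_v, mul_zero, add_zero, hr, res_totalSq_of_eq hr,
      mul_comm] at h1
    have h2 := mul_left_cancel₀ (pow_ne_zero _ Polynomial.X_ne_zero) h1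
    have h3 := coeff_one_res α
    rw [h2, Polynomial.coeff_one_add_X_pow, Nat.choose_one_right,
      natCast_eq_one_of_odd (odd_two_mul_add_one l)] at h3
    exact one_ne_zero h3

/-! ### The closed ideals of the classification -/

/-- The ideal `⟨v^i x_n^{2M}, x_{n+1}^M⟩` with `M = 2^t`. For `n = 0` these are fibered ideals, as
`x_0 = 1`; for `n ≥ 1` and `1 ≤ i ≤ M` they are the twisted and the mixed ideals. -/
def chainIdeal (n t i : ℕ) : Ideal H :=
  Ideal.span {v ^ i * x n ^ (2 * 2 ^ t), x (n + 1) ^ 2 ^ t}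

theorem dickson_pow_mul_totalSq_x_pow (n t : ℕ) :
    dickson ^ (2 * 2 ^ t) * totalSq (x n ^ (2 * 2 ^ t)) =
      x n ^ (2 * 2 ^ t) * (1 + u ^ 2 ^ t + (v ^ 2 ^ t) ^ 2 * x n ^ (2 * 2 ^ t)) +
        x (n + 1) ^ 2 ^ t + (x (n + 1) ^ 2 ^ t) ^ 2 := by
  have h := congrArg (· ^ 2 ^ t) (dickson_mul_totalSq_x n).1
  simp only [add_pow_char_pow, mul_pow, one_pow] at h
  rw [map_pow, pow_mul, pow_mul, pow_mul, h, ← pow_mul v, ← pow_mul v, ← pow_mul (x (n + 1)),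
    ← pow_mul (x (n + 1)), mul_comm 2]

theorem dickson_pow_mul_totalSq_x_succ_pow (n t : ℕ) :
    dickson ^ 2 ^ t * totalSq (x (n + 1) ^ 2 ^ t) =
      x (n + 1) ^ 2 ^ t + v ^ 2 ^ t * x n ^ (2 * 2 ^ t) +
        u ^ 2 ^ t * (x (n + 1) ^ 2 ^ t) ^ 2 + (v ^ 2 ^ t) ^ 2 * (x n ^ (2 * 2 ^ t)) ^ 2 +
        v ^ 2 ^ t * (x (n + 1) ^ 2 ^ t) ^ 2 := by
  have h := congrArg (· ^ 2 ^ t) (dickson_mul_totalSq_x n).2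
  simp only [x_add_two, add_pow_char_pow, mul_pow] at h
  rw [map_pow, h]
  ring

theorem fullRadical_of_prime {I : Ideal H}
    (h : ∀ P : Ideal H, P.IsPrime → I ≤ P → u ∈ P ∧ v ∈ P) : FullRadical I := by
  rw [FullRadical, Ideal.radical_eq_sInf, Ideal.mem_sInf, Ideal.mem_sInf]
  exact ⟨fun P hP => (h P hP.2 hP.1).1, fun P hP => (h P hP.2 hP.1).2⟩

theorem u_mem_of_x_mem {P : Ideal H} (hP : P.IsPrime) (hv : v ∈ P) :
    ∀ n, x n ∈ P → u ∈ P
  | 0, h => absurd ((Ideal.eq_top_iff_one P).2 h) hP.ne_top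
  | 1, h => h
  | n + 2, h => by
    rw [x_add_two] at h
    have h1 : u * x (n + 1) ^ 2 ∈ P := by
      have h2 : v ^ 2 * x n ^ 4 ∈ P := P.mul_mem_right _ (P.pow_mem_of_mem hv 2 (by norm_num))
      simpa using sub_mem h h2
    rcases hP.mem_or_mem h1 with h2 | h2
    · exact h2
    · exact u_mem_of_x_mem hP hv (n + 1) (hP.mem_of_pow_mem _ h2)

theorem v_mem_of_x_mem {P : Ideal H} (hP : P.IsPrime) :
    ∀ n, x n ∈ P → x (n + 1) ∈ P → v ∈ P
  | 0, h, _ => absurd ((Ideal.eq_top_iff_one P).2 h) hP.ne_top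
  | n + 1, h, h' => by
    rw [x_add_two] at h'
    have h1 : v ^ 2 * x n ^ 4 ∈ P := by
      have h2 : u * x (n + 1) ^ 2 ∈ P := P.mul_mem_left _ (P.pow_mem_of_mem h 2 (by norm_num))
      simpa using sub_mem h' h2
    rcases hP.mem_or_mem h1 with h2 | h2
    · exact hP.mem_of_pow_mem _ h2
    · exact v_mem_of_x_mem hP n (hP.mem_of_pow_mem _ h2) h

theorem chainIdeal_fullRadical (n t i : ℕ) : FullRadical (chainIdeal n t i) := by
  apply fullRadical_of_prime
  intro P hP hle
  have h1 : v ^ i * x n ^ (2 * 2 ^ t) ∈ P := hle (Ideal.subset_span (by simp))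
  have h2 : x (n + 1) ∈ P :=
    hP.mem_of_pow_mem (2 ^ t) (hle (Ideal.subset_span (by simp)))
  have hv : v ∈ P := by
    rcases hP.mem_or_mem h1 with h3 | h3
    · exact hP.mem_of_pow_mem _ h3
    · exact v_mem_of_x_mem hP n (hP.mem_of_pow_mem _ h3) h2
  exact ⟨u_mem_of_x_mem hP hv _ h2, hv⟩

theorem chainIdeal_isSteenrodClosed {n t i : ℕ} (hi : i ≤ 2 ^ t) :
    IsSteenrodClosed (chainIdeal n t i) := by
  have hfull := chainIdeal_fullRadical n t i
  obtain ⟨k, hk⟩ := Nat.exists_eq_add_of_le hi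
  unfold chainIdeal at *
  apply isSteenrodClosed_span_pair
  · apply hfull.mem_of_dickson_pow_mul_mem (n := 2 * 2 ^ t)
    rw [map_mul, map_pow, totalSq_v, mul_left_comm, dickson_pow_mul_totalSq_x_pow]
    generalize x n ^ (2 * 2 ^ t) = A
    generalize x (n + 1) ^ 2 ^ t = B
    refine Ideal.mem_span_pair.2 ⟨dickson ^ i * (1 + u ^ 2 ^ t + (v ^ 2 ^ t) ^ 2 * A),
      v ^ i * dickson ^ i * (1 + B), ?_⟩
    ring
  · apply hfull.mem_of_dickson_pow_mul_mem (n := 2 ^ t)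
    rw [dickson_pow_mul_totalSq_x_succ_pow]
    generalize x n ^ (2 * 2 ^ t) = A
    generalize x (n + 1) ^ 2 ^ t = B
    refine Ideal.mem_span_pair.2 ⟨v ^ k * (1 + v ^ 2 ^ t * A), 1 + (u ^ 2 ^ t + v ^ 2 ^ t) * B, ?_⟩
    rw [hk]
    ring

theorem fiberedIdeal_fullRadical (p : ℕ × ℕ) : FullRadical (fiberedIdeal p) :=
  ⟨⟨p.2, Ideal.subset_span (by simp)⟩, ⟨p.1, Ideal.subset_span (by simp)⟩⟩

theorem totalSq_u_pow (t s : ℕ) :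
    totalSq (u ^ (2 ^ t * s)) = (u ^ 2 ^ t * (1 + u ^ 2 ^ t) + v ^ 2 ^ t) ^ s := by
  rw [map_pow, totalSq_u, pow_mul, add_pow_char_pow, add_pow_char_pow]
  ring

theorem fiberedIdeal_isSteenrodClosed {k l t : ℕ} (hk : k ≤ 2 ^ t) (ht : 2 ^ t ∣ l) :
    IsSteenrodClosed (fiberedIdeal (k, l)) := by
  obtain ⟨s, rfl⟩ := ht
  apply isSteenrodClosed_span_pair
  · rw [map_pow, totalSq_v, mul_pow]
    exact Ideal.mul_mem_right _ _ (Ideal.subset_span (by simp))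
  · have hv : v ^ 2 ^ t ∈ fiberedIdeal (k, 2 ^ t * s) :=
      Ideal.pow_mem_of_pow_mem _ (Ideal.subset_span (by simp)) hk
    have hu : u ^ (2 ^ t * s) ∈ fiberedIdeal (k, 2 ^ t * s) := Ideal.subset_span (by simp)
    change totalSq (u ^ (2 ^ t * s)) ∈ fiberedIdeal (k, 2 ^ t * s)
    obtain ⟨c, hc⟩ := sub_dvd_pow_sub_pow (u ^ 2 ^ t * (1 + u ^ 2 ^ t) + v ^ 2 ^ t)
      (u ^ 2 ^ t * (1 + u ^ 2 ^ t)) s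
    rw [add_sub_cancel_left] at hc
    rw [totalSq_u_pow, sub_eq_iff_eq_add.1 hc]
    refine add_mem (Ideal.mul_mem_right _ _ hv) ?_
    rw [mul_pow, ← pow_mul]
    exact Ideal.mul_mem_right _ _ hu

theorem x_pow_isHomogeneous (n t : ℕ) :
    ((x n ^ (2 * 2 ^ t) : H) : Poly).IsHomogeneous ((2 ^ (n + 1) - 2) * (2 * 2 ^ t)) :=
  (x_isHomogeneous n).pow _

theorem degree_x_succ_pow (n t : ℕ) :
    (2 ^ (n + 1 + 1) - 2) * 2 ^ t = (2 ^ (n + 1) - 2) * (2 * 2 ^ t) + 2 * 2 ^ t := by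
  have h : 2 ≤ 2 ^ (n + 1) := by
    rw [pow_succ]; have := Nat.one_le_two_pow (n := n); omega
  obtain ⟨k, hk⟩ := Nat.exists_eq_add_of_le h
  rw [pow_succ 2 (n + 1), hk, show (2 + k) * 2 - 2 = 2 + 2 * k by omega,
    show 2 + k - 2 = k by omega]
  ring

theorem x_succ_pow_isHomogeneous (n t : ℕ) :
    ((x (n + 1) ^ 2 ^ t : H) : Poly).IsHomogeneous
      ((2 ^ (n + 1) - 2) * (2 * 2 ^ t) + 2 * 2 ^ t) := by
  rw [← degree_x_succ_pow]
  exact (x_isHomogeneous (n + 1)).pow _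

theorem v_pow_mul_isHomogeneous (n t i : ℕ) :
    ((v ^ i * x n ^ (2 * 2 ^ t) : H) : Poly).IsHomogeneous
      (3 * i + (2 ^ (n + 1) - 2) * (2 * 2 ^ t)) :=
  (isHomogeneous_v.pow i).mul (x_pow_isHomogeneous n t)

theorem res_x_succ_pow (n t : ℕ) : res (x (n + 1) ^ 2 ^ t) =
    Polynomial.X ^ ((2 ^ (n + 1) - 2) * (2 * 2 ^ t) + 2 * 2 ^ t) := by
  rw [map_pow, res_x, ← degree_x_succ_pow, pow_mul]

/-! ### Extending a closed ideal by a factor `v` -/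

theorem exists_two_pow_of_X_pow_dvd {e n : ℕ} (hn : 0 < n)
    (h : (Polynomial.X : Polynomial (ZMod 2)) ^ e ∣ 1 + (1 + Polynomial.X) ^ n) :
    ∃ r, 2 ^ r ∣ n ∧ e ≤ 2 ^ r := by
  obtain ⟨r, s, hs, rfl⟩ := Nat.exists_eq_two_pow_mul_odd hn.ne'
  refine ⟨r, dvd_mul_right _ _, ?_⟩
  by_contra! hlt
  have h1 := (Polynomial.X_pow_dvd_iff.1 h) _ hlt
  obtain ⟨k, hk⟩ := Polynomial.powAddExpansion (1 : Polynomial (ZMod 2)) (Polynomial.X ^ 2 ^ r) s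
  have h2 : (1 : Polynomial (ZMod 2)) + (1 + Polynomial.X) ^ (2 ^ r * s) =
      (1 + k * Polynomial.X ^ 2 ^ r) * Polynomial.X ^ 2 ^ r := by
    rw [pow_mul, add_pow_char_pow, one_pow, hk, natCast_eq_one_of_odd hs, one_pow, one_pow]
    have h3 : (2 : Polynomial (ZMod 2)) = 0 := CharTwo.two_eq_zero
    linear_combination h3
  have h4 := Polynomial.coeff_mul_X_pow (1 + k * Polynomial.X ^ 2 ^ r) (2 ^ r) 0
  rw [zero_add, ← h2, h1, Polynomial.coeff_add, Polynomial.mul_coeff_zero,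
    Polynomial.coeff_X_pow, if_neg (by positivity)] at h4
  simp at h4

theorem X_pow_dvd_of_dvd_mul {e k : ℕ} {f : Polynomial (ZMod 2)}
    (h : Polynomial.X ^ e ∣ (1 + Polynomial.X) ^ k * f) : Polynomial.X ^ e ∣ f := by
  have hc : IsCoprime (Polynomial.X ^ e) ((1 + Polynomial.X : Polynomial (ZMod 2)) ^ k) :=
    IsCoprime.pow ⟨-1, 1, by ring⟩
  exact hc.dvd_of_dvd_mul_left h

theorem not_X_pow_dvd {e k : ℕ} (he : 0 < e) :
    ¬ (Polynomial.X : Polynomial (ZMod 2)) ^ e ∣ (1 + Polynomial.X) ^ k := by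
  intro h
  have h1 := X_pow_dvd_of_dvd_mul (f := 1) (by rwa [mul_one])
  have := (Polynomial.X_pow_dvd_iff.1 h1) 0 he
  simp at this

/-- If `C` and `E` are coprime, then `⟨E, vC⟩ : C = ⟨E, v⟩`. -/
theorem res_dvd_of_mul_mem {E C g : H} (hEC : IsRelPrime (E : Poly) (C : Poly))
    (h : C * g ∈ Ideal.span {E, v * C}) : res E ∣ res g := by
  obtain ⟨α, β, hαβ⟩ := Ideal.mem_span_pair.1 h
  obtain ⟨k, hk⟩ := dvd_of_dvd_mul hEC (h := g - β * v) ⟨α, by linear_combination -hαβ⟩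
  have h1 := congrArg res hk
  rw [map_sub, map_mul, map_mul, res_v, mul_zero, sub_zero] at h1
  exact ⟨_, h1⟩

theorem isRelPrime_of_fullRadical {E C : H} (h : FullRadical (Ideal.span {E, v * C})) :
    IsRelPrime (E : Poly) (C : Poly) :=
  IsRelPrime.of_mul_right_right (y := (v : Poly)) (z := (C : Poly)) h.isRelPrime

theorem res_dickson : res dickson = (1 + Polynomial.X) ^ 2 := by
  have h3 : (2 : Polynomial (ZMod 2)) = 0 := CharTwo.two_eq_zero
  simp only [dickson, map_add, map_one, res_u, res_v]
  linear_combination (- Polynomial.X) * h3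

theorem one_add_X_pow (t : ℕ) : (1 + Polynomial.X ^ (2 * 2 ^ t) : Polynomial (ZMod 2)) =
    (1 + Polynomial.X) ^ (2 * 2 ^ t) := by
  rw [← pow_succ', add_pow_char_pow, one_pow]

/-- The quotient map of an ideal. Forgetting how the quotient is built makes computations in it
cheaper. -/
theorem exists_quotient_hom (I : Ideal H) :
    ∃ (Q : Type) (_ : CommRing Q) (π : H →+* Q), ∀ z, π z = 0 ↔ z ∈ I :=
  ⟨H ⧸ I, inferInstance, Ideal.Quotient.mk I, fun _ => Ideal.Quotient.eq_zero_iff_mem⟩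

/-- An extension `⟨x_{n+1}^M + h v^i x_n^{2M}, v^{i+1} x_n^{2M}⟩` of a chain ideal with `i < M` is
closed only if `h` vanishes modulo `v`. -/
theorem res_eq_zero_of_isSteenrodClosed_low {n t i d : ℕ} {h : H} (hi : 1 ≤ i) (hit : i < 2 ^ t)
    (hd : d + 3 * i = 2 * 2 ^ t) (hh : (h : Poly).IsHomogeneous d)
    (hcl : IsSteenrodClosed (Ideal.span {x (n + 1) ^ 2 ^ t + h * (v ^ i * x n ^ (2 * 2 ^ t)),
      v * (v ^ i * x n ^ (2 * 2 ^ t))}))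
    (hfull : FullRadical (Ideal.span {x (n + 1) ^ 2 ^ t + h * (v ^ i * x n ^ (2 * 2 ^ t)),
      v * (v ^ i * x n ^ (2 * 2 ^ t))})) : res h = 0 := by
  by_contra hne
  have hrh := res_ne_zero hh hne
  have hrel := isRelPrime_of_fullRadical hfull
  have hA := dickson_pow_mul_totalSq_x_pow n t
  have hB := dickson_pow_mul_totalSq_x_succ_pow n t
  have hrE : res (x (n + 1) ^ 2 ^ t + h * (v ^ i * x n ^ (2 * 2 ^ t))) =
      Polynomial.X ^ ((2 ^ (n + 1) - 2) * (2 * 2 ^ t) + 2 * 2 ^ t) := by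
    rw [map_add, res_x_succ_pow, map_mul, map_mul, map_pow, res_v, zero_pow (by omega), zero_mul,
      mul_zero, add_zero]
  generalize x n ^ (2 * 2 ^ t) = A at *
  generalize x (n + 1) ^ 2 ^ t = B at *
  obtain ⟨j, hj⟩ := Nat.exists_eq_add_of_lt hit
  obtain ⟨i', rfl⟩ : ∃ i', i = i' + 1 := ⟨i - 1, by omega⟩
  set I := Ideal.span {B + h * (v ^ (i' + 1) * A), v * (v ^ (i' + 1) * A)} with hI
  obtain ⟨Q, _, π, hπ⟩ := exists_quotient_hom I
  have e1 : π (B + h * (v ^ (i' + 1) * A)) = 0 :=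
    (hπ _).2 (Ideal.subset_span (by simp))
  have e2 : π (v * (v ^ (i' + 1) * A)) = 0 :=
    (hπ _).2 (Ideal.subset_span (by simp))
  have hS := (hπ _).2
    (I.mul_mem_left (dickson ^ (2 * 2 ^ t)) (hcl _ (Ideal.subset_span (Set.mem_insert _ _))))
  have eS : dickson ^ (2 * 2 ^ t) * totalSq (B + h * (v ^ (i' + 1) * A)) =
      dickson ^ 2 ^ t * (dickson ^ 2 ^ t * totalSq B) + totalSq h * v ^ (i' + 1) *
        dickson ^ (i' + 1) * (dickson ^ (2 * 2 ^ t) * totalSq A) := by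
    rw [map_add, map_mul, map_mul, map_pow, totalSq_v]
    ring
  rw [eS, hA, hB, hj] at hS
  have two := congrArg π two_eq_zero'
  simp only [map_add, map_mul, map_pow, map_one, map_zero, map_ofNat] at e1 e2 hS two
  have key : A * v ^ (i' + 1) * (dickson ^ 2 ^ t * h +
      totalSq h * dickson ^ (i' + 1) * (1 + u ^ 2 ^ t)) ∈ I := by
    rw [← hπ]
    rw [hj]
    simp only [map_add, map_mul, map_pow, map_one]
    generalize π A = A' at *
    generalize π B = B' at *
    generalize π h = h' at *
    generalize π v = v' at *
    generalize π (totalSq h) = s' at *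
    generalize π dickson ^ (i' + 1 + j + 1) = D' at *
    generalize π dickson ^ (i' + 1) = D'' at *
    generalize π u ^ (i' + 1 + j + 1) = R' at *
    have e3 : v' * B' = 0 := by linear_combination v' * e1 - h' * e2
    have e4 : B' ^ 2 = 0 := by linear_combination B' * e1 - h' * A' * v' ^ i' * e3
    have e5 : v' ^ (i' + 1 + j + 1) * A' = 0 := by linear_combination v' ^ j * e2
    rw [e4] at hS
    linear_combination hS - D' * e1 + D' * h' * v' ^ (i' + 1) * A' * two -
      (D' + D' * v' ^ (i' + 1 + j + 1) * A' + s' * v' ^ (i' + 1) * D'' *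
        v' ^ (i' + 1 + j + 1) * A') * e5 - s' * v' ^ i' * D'' * e3
  have hdvd := res_dvd_of_mul_mem hrel (g := dickson ^ 2 ^ t * h +
      totalSq h * dickson ^ (i' + 1) * (1 + u ^ 2 ^ t)) (by rw [mul_comm A] at key; exact key)
  rw [hrE, map_add, map_mul, map_mul, map_mul, map_add, map_pow, map_pow, map_pow, map_one, res_u,
    res_dickson, hrh, res_totalSq_of_eq hrh, ← pow_mul, ← pow_mul, ← pow_mul, one_add_X_pow] at hdvd
  have e6 : (1 + Polynomial.X) ^ (2 * 2 ^ t) * Polynomial.X ^ d +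
      Polynomial.X ^ d * (1 + Polynomial.X) ^ d * (1 + Polynomial.X) ^ (2 * (i' + 1)) *
        (1 + Polynomial.X) ^ (2 * 2 ^ t) = Polynomial.X ^ d * ((1 + Polynomial.X) ^ (2 * 2 ^ t) *
      (1 + (1 + Polynomial.X : Polynomial (ZMod 2)) ^ (d + 2 * (i' + 1)))) := by ring
  rw [e6] at hdvd
  have h7 := (pow_dvd_pow _ (show d + 3 * (i' + 1) ≤ _ by omega)).trans hdvd
  rw [pow_add, mul_dvd_mul_iff_left (pow_ne_zero _ Polynomial.X_ne_zero)] at h7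
  have h8 := X_pow_dvd_of_dvd_mul h7
  obtain ⟨r, hr1, hr2⟩ := exists_two_pow_of_X_pow_dvd (by omega) h8
  have hr3 : 2 ^ r ∣ 2 * 2 ^ t := by
    have hle := Nat.le_of_dvd (by omega) hr1
    rw [← pow_succ']
    apply pow_dvd_pow
    apply (Nat.pow_le_pow_iff_right (a := 2) (by norm_num)).1
    rw [pow_succ']
    omega
  have hr4 : 2 ^ r ∣ i' + 1 := by
    have : 2 * 2 ^ t = (d + 2 * (i' + 1)) + (i' + 1) := by omega
    rw [this] at hr3
    exact (Nat.dvd_add_right hr1).1 hr3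
  have := Nat.le_of_dvd (by omega) hr4
  omega

/-- An extension `⟨v^i x_n^{2M} + h x_{n+1}^M, v x_{n+1}^M⟩` of a chain ideal with `i < M` is
closed only if `h` vanishes modulo `v`. -/
theorem res_eq_zero_of_isSteenrodClosed_high {n t i d : ℕ} {h : H} (hi : 1 ≤ i) (hit : i < 2 ^ t)
    (hd : d + 2 * 2 ^ t = 3 * i) (hh : (h : Poly).IsHomogeneous d)
    (hcl : IsSteenrodClosed (Ideal.span {v ^ i * x n ^ (2 * 2 ^ t) + h * x (n + 1) ^ 2 ^ t,
      v * x (n + 1) ^ 2 ^ t}))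
    (hfull : FullRadical (Ideal.span {v ^ i * x n ^ (2 * 2 ^ t) + h * x (n + 1) ^ 2 ^ t,
      v * x (n + 1) ^ 2 ^ t})) : res h = 0 := by
  by_contra hne
  have hrh := res_ne_zero hh hne
  have hrel := isRelPrime_of_fullRadical hfull
  have hA := dickson_pow_mul_totalSq_x_pow n t
  have hB := dickson_pow_mul_totalSq_x_succ_pow n t
  have hrB := res_x_succ_pow n t
  set β := (2 ^ (n + 1) - 2) * (2 * 2 ^ t) + 2 * 2 ^ t with hβ
  have hrE : res (v ^ i * x n ^ (2 * 2 ^ t) + h * x (n + 1) ^ 2 ^ t) =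
      Polynomial.X ^ d * Polynomial.X ^ β := by
    rw [map_add, map_mul, map_mul, map_pow res v, res_v, zero_pow (by omega), zero_mul, zero_add,
      hrB, hrh]
  generalize x n ^ (2 * 2 ^ t) = A at *
  generalize x (n + 1) ^ 2 ^ t = B at *
  obtain ⟨j, hj⟩ := Nat.exists_eq_add_of_lt hit
  obtain ⟨i', rfl⟩ : ∃ i', i = i' + 1 := ⟨i - 1, by omega⟩
  set I := Ideal.span {v ^ (i' + 1) * A + h * B, v * B} with hI
  obtain ⟨Q, _, π, hπ⟩ := exists_quotient_hom I
  have e1 : π (v ^ (i' + 1) * A + h * B) = 0 :=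
    (hπ _).2 (Ideal.subset_span (by simp))
  have e2 : π (v * B) = 0 :=
    (hπ _).2 (Ideal.subset_span (by simp))
  have hS := (hπ _).2
    (I.mul_mem_left (dickson ^ (2 * 2 ^ t)) (hcl _ (Ideal.subset_span (Set.mem_insert _ _))))
  have eS : dickson ^ (2 * 2 ^ t) * totalSq (v ^ (i' + 1) * A + h * B) =
      v ^ (i' + 1) * dickson ^ (i' + 1) * (dickson ^ (2 * 2 ^ t) * totalSq A) +
      totalSq h * dickson ^ 2 ^ t * (dickson ^ 2 ^ t * totalSq B) := by
    rw [map_add, map_mul, map_mul, map_pow, totalSq_v]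
    ring
  rw [eS, hA, hB, hj] at hS
  have two := congrArg π two_eq_zero'
  simp only [map_add, map_mul, map_pow, map_one, map_zero, map_ofNat] at e1 e2 hS two
  have key : B * (h * dickson ^ (i' + 1) * (1 + u ^ 2 ^ t) +
      totalSq h * dickson ^ 2 ^ t * (1 + u ^ 2 ^ t * B)) ∈ I := by
    rw [← hπ]
    rw [hj]
    simp only [map_add, map_mul, map_pow, map_one]
    generalize π A = A' at *
    generalize π B = B' at *
    generalize π h = h' at *
    generalize π v = v' at *
    generalize π (totalSq h) = s' at *
    generalize π dickson ^ (i' + 1 + j + 1) = D' at *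
    generalize π dickson ^ (i' + 1) = D'' at *
    generalize π u ^ (i' + 1 + j + 1) = R' at *
    have e3 : v' ^ (i' + 1 + j + 1) * A' = 0 := by
      linear_combination v' ^ (j + 1) * e1 - v' ^ j * h' * e2
    linear_combination hS - D'' * (1 + R') * e1 + h' * B' * D'' * (1 + R') * two -
      v' ^ i' * D'' * (1 + B') * e2 - s' * D' * v' ^ (i' + 1 + j) * B' * e2 -
      (v' ^ (i' + 1) * D'' * v' ^ (i' + 1 + j + 1) * A' + s' * D' +
        s' * D' * v' ^ (i' + 1 + j + 1) * A') * e3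
  have hdvd := res_dvd_of_mul_mem hrel key
  rw [hrE, map_add, map_mul, map_mul, map_mul, map_mul, map_add, map_add, map_mul, map_pow,
    map_pow, map_pow, map_one, hrB, res_u, res_dickson, hrh, res_totalSq_of_eq hrh, ← pow_mul,
    ← pow_mul, ← pow_mul, one_add_X_pow] at hdvd
  have hd2 : 2 * (i' + 1) = d + (2 * 2 ^ t - (i' + 1)) := by omega
  have e6 : Polynomial.X ^ d * (1 + Polynomial.X) ^ (2 * (i' + 1)) *
      (1 + Polynomial.X) ^ (2 * 2 ^ t) + Polynomial.X ^ d * (1 + Polynomial.X) ^ d *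
        (1 + Polynomial.X) ^ (2 * 2 ^ t) * (1 + Polynomial.X ^ (2 * 2 ^ t) * Polynomial.X ^ β) =
      Polynomial.X ^ d * ((1 + Polynomial.X) ^ (2 * 2 ^ t + d) *
        (1 + (1 + Polynomial.X : Polynomial (ZMod 2)) ^ (2 * 2 ^ t - (i' + 1)) +
          Polynomial.X ^ (2 * 2 ^ t) * Polynomial.X ^ β)) := by
    rw [hd2]
    ring
  rw [e6, mul_dvd_mul_iff_left (pow_ne_zero _ Polynomial.X_ne_zero)] at hdvd
  have h7 : Polynomial.X ^ (2 * 2 ^ t) ∣ _ := (pow_dvd_pow _ (by omega)).trans hdvd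
  have h8 := (dvd_add_left (dvd_mul_right _ _)).1 (X_pow_dvd_of_dvd_mul h7)
  obtain ⟨r, hr1, hr2⟩ := exists_two_pow_of_X_pow_dvd (by omega) h8
  have := Nat.le_of_dvd (by omega) hr1
  omega

/-- The extension `⟨x_{n+1}^M, v^{M+1} x_n^{2M}⟩` of the last chain ideal is not closed. -/
theorem not_isSteenrodClosed_last {n t : ℕ}
    (hfull : FullRadical (Ideal.span {x (n + 1) ^ 2 ^ t, v * (v ^ 2 ^ t * x n ^ (2 * 2 ^ t))})) :
    ¬ IsSteenrodClosed
      (Ideal.span {x (n + 1) ^ 2 ^ t, v * (v ^ 2 ^ t * x n ^ (2 * 2 ^ t))}) := by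
  intro hcl
  have hrel := isRelPrime_of_fullRadical hfull
  have hB := dickson_pow_mul_totalSq_x_succ_pow n t
  have hrE := res_x_succ_pow n t
  generalize x n ^ (2 * 2 ^ t) = A at *
  generalize x (n + 1) ^ 2 ^ t = B at *
  have hS := Ideal.mul_mem_left _ (dickson ^ 2 ^ t)
    (hcl B (Ideal.subset_span (Set.mem_insert _ _)))
  have hm : dickson ^ 0 * (v ^ 2 ^ t * A * 1) ∈ Ideal.span {B, v * (v ^ 2 ^ t * A)} := by
    rw [hB] at hS
    have h1 : B + v ^ 2 ^ t * A + u ^ 2 ^ t * B ^ 2 + (v ^ 2 ^ t) ^ 2 * A ^ 2 + v ^ 2 ^ t * B ^ 2 -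
        ((1 + u ^ 2 ^ t * B + v ^ 2 ^ t * B) * B + v ^ (2 ^ t - 1) * A * (v * (v ^ 2 ^ t * A)))
        ∈ Ideal.span {B, v * (v ^ 2 ^ t * A)} :=
      sub_mem hS (Ideal.mem_span_pair.2 ⟨_, _, rfl⟩)
    have h2 : v ^ 2 ^ t = v ^ (2 ^ t - 1) * v := by
      rw [← pow_succ, Nat.sub_add_cancel Nat.one_le_two_pow]
    convert h1 using 1
    linear_combination (- v ^ 2 ^ t * A ^ 2) * h2
  have hdvd := res_dvd_of_mul_mem hrel (hfull.mem_of_dickson_pow_mul_mem hm)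
  rw [hrE, map_one, ← pow_zero (1 + Polynomial.X)] at hdvd
  exact not_X_pow_dvd (by positivity) hdvd

theorem pow_add_of_sq_eq_zero {R : Type*} [CommRing R] {y z : R} {s : ℕ} (hz : z ^ 2 = 0) :
    (y + z) ^ s = y ^ s + s * y ^ (s - 1) * z := by
  obtain ⟨k, hk⟩ := Polynomial.powAddExpansion y z s
  rw [hk, hz, mul_zero, add_zero]

/-- An extension `⟨u^l + h v^k, v^{k+1}⟩` of a fibered ideal is closed only if `k` is less than the
largest power of `2` dividing `l` and `h` vanishes modulo `v`. -/
theorem res_eq_zero_of_isSteenrodClosed_fibered {t s i d : ℕ} {h : H} (hs : Odd s) (hi : 1 ≤ i)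
    (hit : i ≤ 2 ^ t) (hd : d + 3 * i = 2 * (2 ^ t * s)) (hh : (h : Poly).IsHomogeneous d)
    (hcl : IsSteenrodClosed (Ideal.span {u ^ (2 ^ t * s) + h * v ^ i, v * v ^ i}))
    (hfull : FullRadical (Ideal.span {u ^ (2 ^ t * s) + h * v ^ i, v * v ^ i})) :
    i < 2 ^ t ∧ res h = 0 := by
  have hrel := isRelPrime_of_fullRadical hfull
  have hrE : res (u ^ (2 ^ t * s) + h * v ^ i) = Polynomial.X ^ (2 * (2 ^ t * s)) := by
    rw [map_add, map_mul, map_pow, map_pow, res_v, zero_pow (by omega), mul_zero, add_zero, res_u,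
      ← pow_mul]
  set I := Ideal.span {u ^ (2 ^ t * s) + h * v ^ i, v * v ^ i} with hI
  obtain ⟨Q, _, π, hπ⟩ := exists_quotient_hom I
  have e1 : π (u ^ (2 ^ t * s) + h * v ^ i) = 0 :=
    (hπ _).2 (Ideal.subset_span (by simp))
  have e2 : π (v * v ^ i) = 0 :=
    (hπ _).2 (Ideal.subset_span (by simp))
  have hS := (hπ _).2 (hcl _ (Ideal.subset_span (Set.mem_insert _ _)))
  rw [map_add, totalSq_u_pow, map_mul, map_pow, totalSq_v] at hS
  rw [pow_mul] at e1
  have two := congrArg π two_eq_zero'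
  simp only [map_add, map_mul, map_pow, map_one, map_zero, map_ofNat] at e1 e2 hS two
  rcases Nat.lt_or_eq_of_le hit with hlt | heq
  · refine ⟨hlt, ?_⟩
    by_contra hne
    have hrh := res_ne_zero hh hne
    have key : v ^ i * (h * (1 + u ^ 2 ^ t) ^ s + totalSq h * dickson ^ i) ∈ I := by
      rw [← hπ]
      simp only [map_add, map_mul, map_pow, map_one]
      have e3 : π v ^ 2 ^ t = 0 := by
        obtain ⟨j, hj⟩ := Nat.exists_eq_add_of_lt hlt
        rw [hj]
        linear_combination π v ^ j * e2
      rw [e3, add_zero, mul_pow] at hS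
      linear_combination hS - (1 + π u ^ 2 ^ t) ^ s * e1 +
        (1 + π u ^ 2 ^ t) ^ s * π h *
          π v ^ i * two
    have hdvd := res_dvd_of_mul_mem hrel key
    rw [hrE, map_add, map_mul, map_mul, map_pow, map_add, map_pow, map_pow, map_one, res_u,
      res_dickson, hrh, res_totalSq_of_eq hrh, ← pow_mul, ← pow_mul, one_add_X_pow, ← pow_mul] at hdvd
    have e6 : Polynomial.X ^ d * (1 + Polynomial.X) ^ (2 * 2 ^ t * s) +
        Polynomial.X ^ d * (1 + Polynomial.X) ^ d * (1 + Polynomial.X) ^ (2 * i) =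
        Polynomial.X ^ d * ((1 + Polynomial.X) ^ (d + 2 * i) *
          (1 + (1 + Polynomial.X : Polynomial (ZMod 2)) ^ i)) := by
      rw [mul_assoc, ← hd]
      ring
    rw [e6, ← hd, pow_add, mul_dvd_mul_iff_left (pow_ne_zero _ Polynomial.X_ne_zero)] at hdvd
    obtain ⟨r, hr1, hr2⟩ := exists_two_pow_of_X_pow_dvd hi (X_pow_dvd_of_dvd_mul hdvd)
    have := Nat.le_of_dvd hi hr1
    omega
  · exfalso
    subst heq
    have key : v ^ 2 ^ t * (h * (1 + u ^ 2 ^ t) ^ s + totalSq h * dickson ^ 2 ^ t +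
        (u ^ 2 ^ t * (1 + u ^ 2 ^ t)) ^ (s - 1)) ∈ I := by
      rw [← hπ]
      simp only [map_add, map_mul, map_pow, map_one]
      have e3 : (π v ^ 2 ^ t) ^ 2 = 0 := by
        obtain ⟨j, hj⟩ := Nat.exists_eq_add_of_le (Nat.one_le_two_pow (n := t))
        rw [hj] at e2 ⊢
        linear_combination π v ^ j * e2
      have hsQ : (s : Q) = 1 := by
        have := congrArg π (natCast_eq_one_of_odd (R := H) hs)
        simpa using this
      rw [pow_add_of_sq_eq_zero e3, hsQ, one_mul, mul_pow] at hS
      linear_combination hS - (1 + π u ^ 2 ^ t) ^ s * e1 +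
        (1 + π u ^ 2 ^ t) ^ s * π h *
          π v ^ 2 ^ t * two
    have hdvd := res_dvd_of_mul_mem hrel key
    obtain ⟨s', rfl⟩ : ∃ s', s = s' + 1 := ⟨s - 1, by have := hs.pos; omega⟩
    have hpos : 0 < 2 ^ t := by positivity
    have e7 : 2 * (2 ^ t * (s' + 1)) = 2 * 2 ^ t * s' + 2 ^ t + 2 ^ t := by ring
    rw [hrE, map_add, map_add, map_mul, map_mul, map_pow, map_pow, map_pow, map_mul, map_add,
      map_pow, map_one, res_u, res_dickson, ← pow_mul, ← pow_mul, one_add_X_pow,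
      Nat.add_sub_cancel] at hdvd
    rcases restrict_eq_zero_or hh with hrh | hrh <;> rw [← res_apply] at hrh
    · rw [res_totalSq, hrh, map_zero, zero_mul, zero_mul, zero_add, zero_add, mul_pow, ← pow_mul,
        ← pow_mul, e7, add_assoc, pow_add,
        mul_dvd_mul_iff_left (pow_ne_zero _ Polynomial.X_ne_zero)] at hdvd
      exact not_X_pow_dvd (by omega) hdvd
    · have hd' : d + 2 ^ t = 2 * 2 ^ t * s' := by
        rw [e7] at hd
        omega
      have e8 : (1 + (1 + Polynomial.X) ^ 2 ^ t : Polynomial (ZMod 2)) =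
          Polynomial.X ^ 2 ^ t := by
        rw [add_pow_char_pow, one_pow, ← add_assoc, CharTwo.add_self_eq_zero, zero_add]
      have e9 : Polynomial.X ^ d * ((1 + Polynomial.X) ^ (2 * 2 ^ t)) ^ (s' + 1) +
          Polynomial.X ^ d * (1 + Polynomial.X) ^ d * (1 + Polynomial.X) ^ (2 * 2 ^ t) +
          (Polynomial.X ^ (2 * 2 ^ t) * (1 + Polynomial.X) ^ (2 * 2 ^ t)) ^ s' =
          Polynomial.X ^ (2 * 2 ^ t * s' + 2 ^ t) *
            (1 + Polynomial.X : Polynomial (ZMod 2)) ^ (2 * 2 ^ t * s') := by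
        have e10 : Polynomial.X ^ d * ((1 + Polynomial.X) ^ (2 * 2 ^ t)) ^ (s' + 1) +
            Polynomial.X ^ d * (1 + Polynomial.X) ^ d * (1 + Polynomial.X) ^ (2 * 2 ^ t) =
            Polynomial.X ^ d * (1 + Polynomial.X) ^ (2 * 2 ^ t * s' + 2 ^ t) *
              (1 + (1 + Polynomial.X : Polynomial (ZMod 2)) ^ 2 ^ t) := by
          rw [← hd', ← pow_mul, mul_add (2 * 2 ^ t), ← hd']
          ring
        have e11 : Polynomial.X ^ d * (1 + Polynomial.X) ^ (2 * 2 ^ t * s' + 2 ^ t) *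
            Polynomial.X ^ 2 ^ t = Polynomial.X ^ (2 * 2 ^ t * s') *
              (1 + Polynomial.X : Polynomial (ZMod 2)) ^ (2 * 2 ^ t * s' + 2 ^ t) := by
          rw [← hd']
          ring
        rw [e10, e8, e11, mul_pow, ← pow_mul, ← pow_mul, pow_add _ _ (2 ^ t),
          pow_add _ _ (2 ^ t)]
        linear_combination (Polynomial.X ^ (2 * 2 ^ t * s') * (1 + Polynomial.X) ^ (2 * 2 ^ t * s'))
          * e8
      rw [hrh, res_totalSq_of_eq hrh, e9, e7, pow_add _ _ (2 ^ t),
        mul_dvd_mul_iff_left (pow_ne_zero _ Polynomial.X_ne_zero)] at hdvd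
      exact not_X_pow_dvd (by omega) hdvd

/-! ### The classification -/

theorem three_mul_ne {i t s : ℕ} (hi : 1 ≤ i) (hit : i ≤ 2 ^ t) : 3 * i ≠ 2 * (2 ^ t * s) := by
  intro h
  have h1 : 2 * 2 ^ t ∣ 3 * i := ⟨s, by rw [h]; ring⟩
  have h2 : Nat.Coprime (2 * 2 ^ t) 3 := by
    rw [← pow_succ']
    exact Nat.Coprime.pow_left _ (by norm_num)
  have := Nat.le_of_dvd hi (h2.dvd_of_dvd_mul_left h1)
  omega

/-- A closed ideal with `v`-colon a chain ideal is again a chain ideal. -/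
theorem exists_eq_chainIdeal {n t i p q : ℕ} {A B : H} (hi : 1 ≤ i) (hit : i ≤ 2 ^ t)
    (hA : (A : Poly).IsHomogeneous p) (hB : (B : Poly).IsHomogeneous q)
    (hK : chainIdeal n t i = Ideal.span {A, B})
    (hcl : IsSteenrodClosed (Ideal.span {A, v * B}))
    (hfull : FullRadical (Ideal.span {A, v * B})) :
    ∃ n' t' i', 1 ≤ i' ∧ i' ≤ 2 ^ t' ∧ Ideal.span {A, v * B} = chainIdeal n' t' i' := by
  have hKf := chainIdeal_fullRadical n t i
  have hC := v_pow_mul_isHomogeneous n t i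
  have hD := x_succ_pow_isHomogeneous n t
  have hpos : 0 < 2 ^ t := by positivity
  have hne := three_mul_ne (s := 1) hi hit
  rw [mul_one] at hne
  have hrC : res (v ^ i * x n ^ (2 * 2 ^ t)) = 0 := by
    rw [map_mul, map_pow, res_v, zero_pow (by omega), zero_mul]
  unfold chainIdeal at hK hKf
  rcases Nat.lt_or_gt_of_ne hne with hlt | hgt
  · rcases generators_of_span_eq hC hD (by omega) hA hB
      (ne_zero_of_isRelPrime hKf.isRelPrime hD (by omega))
      (hKf.notMem_span_singleton hC (by omega)) hK with
      ⟨-, -, rfl, e, -, rfl⟩ | ⟨-, -, rfl, e, he, rfl⟩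
    · exact absurd hfull (not_fullRadical_of_res_eq_zero hrC (by simp))
    · have hre := res_eq_zero_of_isSteenrodClosed_low hi (by omega) (d := _) (by omega) he hcl hfull
      obtain ⟨e', rfl⟩ := v_dvd_iff.2 hre
      refine ⟨n, t, i + 1, by omega, by omega, ?_⟩
      rw [show v * e' * (v ^ i * x n ^ (2 * 2 ^ t)) = e' * (v * (v ^ i * x n ^ (2 * 2 ^ t))) by ring,
        Ideal.span_pair_add_mul_right, Set.pair_comm, chainIdeal, pow_succ' v i, mul_assoc v]
  · rw [Set.pair_comm] at hK hKf
    rcases generators_of_span_eq hD hC (by omega) hA hB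
      (ne_zero_of_isRelPrime hKf.isRelPrime hC (by omega))
      (hKf.notMem_span_singleton hD (by omega)) hK with
      ⟨-, -, rfl, e, -, rfl⟩ | ⟨-, -, rfl, e, he, rfl⟩
    · rw [mul_add, ← mul_assoc v e, Ideal.span_pair_add_mul_left] at hcl hfull ⊢
      rcases Nat.lt_or_eq_of_le hit with hlt | rfl
      · refine ⟨n, t, i + 1, by omega, by omega, ?_⟩
        rw [Set.pair_comm, chainIdeal, pow_succ' v i, mul_assoc v]
      · exact absurd hcl (not_isSteenrodClosed_last hfull)
    · have hre : res e ≠ 0 := by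
        intro hre
        refine not_fullRadical_of_res_eq_zero ?_ (by simp) hfull
        rw [map_add, hrC, map_mul, hre, zero_mul, zero_add]
      rcases Nat.lt_or_eq_of_le hit with hlt | rfl
      · exact absurd (res_eq_zero_of_isSteenrodClosed_high hi hlt (d := _) (by omega) he hcl hfull)
          hre
      · have hd : 3 * 2 ^ t + (2 ^ (n + 1) - 2) * (2 * 2 ^ t) -
            ((2 ^ (n + 1) - 2) * (2 * 2 ^ t) + 2 * 2 ^ t) = 2 ^ t := by omega
        rw [hd] at he
        cases t with
        | zero =>
          rw [pow_zero] at he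
          rw [eq_zero_of_isHomogeneous_one he, map_zero] at hre
          exact absurd rfl hre
        | succ t =>
          obtain ⟨e', he'⟩ : v ∣ e - u ^ 2 ^ t := by
            rw [v_dvd_iff, map_sub, res_ne_zero he hre, map_pow, res_u, ← pow_mul, ← pow_succ',
              sub_self]
          refine ⟨n + 1, t, 1, le_rfl, Nat.one_le_two_pow, ?_⟩
          have h1 : v ^ 2 ^ (t + 1) * x n ^ (2 * 2 ^ (t + 1)) + e * x (n + 1) ^ 2 ^ (t + 1) =
              x (n + 1 + 1) ^ 2 ^ t + e' * (v * x (n + 1) ^ 2 ^ (t + 1)) := by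
            rw [sub_eq_iff_eq_add.1 he', x_add_two, add_pow_char_pow]
            ring
          rw [h1, Ideal.span_pair_add_mul_right, Set.pair_comm, chainIdeal, pow_one, ← pow_succ']

/-- A closed ideal with `v`-colon a fibered ideal outside the chains is again fibered. -/
theorem exists_eq_fiberedIdeal {t s i p q : ℕ} {A B : H} (hs : Odd s) (hs3 : 3 ≤ s) (hi : 1 ≤ i)
    (hit : i ≤ 2 ^ t) (hA : (A : Poly).IsHomogeneous p) (hB : (B : Poly).IsHomogeneous q)
    (hK : fiberedIdeal (i, 2 ^ t * s) = Ideal.span {A, B})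
    (hcl : IsSteenrodClosed (Ideal.span {A, v * B}))
    (hfull : FullRadical (Ideal.span {A, v * B})) :
    i + 1 ≤ 2 ^ t ∧ Ideal.span {A, v * B} = fiberedIdeal (i + 1, 2 ^ t * s) := by
  have hKf := fiberedIdeal_fullRadical (i, 2 ^ t * s)
  have hC : ((v ^ i : H) : Poly).IsHomogeneous (3 * i) := isHomogeneous_v.pow i
  have hD : ((u ^ (2 ^ t * s) : H) : Poly).IsHomogeneous (2 * (2 ^ t * s)) :=
    isHomogeneous_u.pow _
  have hlt : 3 * i < 2 * (2 ^ t * s) := by nlinarith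
  unfold fiberedIdeal at hK hKf
  rcases generators_of_span_eq hC hD hlt hA hB
      (ne_zero_of_isRelPrime hKf.isRelPrime hD (by omega))
      (hKf.notMem_span_singleton hC (by omega)) hK with
      ⟨-, -, rfl, e, -, rfl⟩ | ⟨-, -, rfl, e, he, rfl⟩
  · refine absurd hfull (not_fullRadical_of_res_eq_zero ?_ (by simp))
    rw [map_pow, res_v, zero_pow (by omega)]
  · obtain ⟨h1, h2⟩ := res_eq_zero_of_isSteenrodClosed_fibered hs hi hit (d := _) (by omega) he
      hcl hfull
    obtain ⟨e', rfl⟩ := v_dvd_iff.2 h2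
    refine ⟨h1, ?_⟩
    rw [show v * e' * v ^ i = e' * (v * v ^ i) by ring, Ideal.span_pair_add_mul_right,
      Set.pair_comm, fiberedIdeal, pow_succ' v i]

theorem chainIdeal_zero (t i : ℕ) : chainIdeal 0 t i = fiberedIdeal (i, 2 ^ t) := by
  rw [chainIdeal, fiberedIdeal, x_zero, zero_add, x_one, one_pow, mul_one]

/-- Every Steenrod closed parameter ideal is a chain ideal or a fibered ideal. The proof is by
induction on the degrees of the parameters, passing from the ideal to its colon ideal by `v`. -/
theorem exists_eq_of_isSteenrodClosed (N : ℕ) : ∀ {I : Ideal H} {X Y : H} {p q : ℕ},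
    p + q = N → IsSteenrodClosed I → FullRadical I → (X : Poly).IsHomogeneous p →
    (Y : Poly).IsHomogeneous q → 0 < p → 0 < q → I = Ideal.span {X, Y} →
    (∃ n t i, 1 ≤ i ∧ i ≤ 2 ^ t ∧ I = chainIdeal n t i) ∨
      (∃ t s i, Odd s ∧ 3 ≤ s ∧ 1 ≤ i ∧ i ≤ 2 ^ t ∧ I = fiberedIdeal (i, 2 ^ t * s)) := by
  induction N using Nat.strong_induction_on with
  | _ N ih =>
    intro I X Y p q hN hcl hfull hX hY hp hq hI
    obtain ⟨A, B, m, n, hA, hB, hm, hmn, rfl⟩ :=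
      exists_generators_v_mul hcl hfull hX hY hp hq hI
    have hvB : v * B ≠ 0 := ne_zero_of_isRelPrime hfull.isRelPrime.symm hA hm
    rcases Nat.eq_zero_or_pos n with rfl | hn
    · have hB1 : B = 1 := (eq_zero_or_one_of_isHomogeneous_zero hB).resolve_left
        (right_ne_zero_of_mul hvB)
      rw [hB1, mul_one] at hcl hfull ⊢
      obtain ⟨l, hl, h⟩ := eq_span_of_v_mem hcl hfull hA hm
      obtain ⟨t, s, hs, rfl⟩ := Nat.exists_eq_two_pow_mul_odd (n := l) (by omega)
      have hs' : s = 1 ∨ 3 ≤ s := by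
        obtain ⟨k, rfl⟩ := hs
        omega
      rcases hs' with rfl | hs3
      · refine Or.inl ⟨0, t, 1, le_rfl, Nat.one_le_two_pow, ?_⟩
        rw [h, chainIdeal_zero, fiberedIdeal, pow_one, mul_one]
      · refine Or.inr ⟨t, s, 1, hs, hs3, le_rfl, Nat.one_le_two_pow, ?_⟩
        rw [h, fiberedIdeal, pow_one]
    · obtain ⟨hcl', hfull'⟩ := isSteenrodClosed_of_v_mul hcl hfull
      rcases ih (m + n) (by omega) rfl hcl' hfull' hA hB hm hn rfl with
        ⟨n', t, i, hi, hit, hK⟩ | ⟨t, s, i, hs, hs3, hi, hit, hK⟩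
      · exact Or.inl (exists_eq_chainIdeal hi hit hA hB hK.symm hcl hfull)
      · obtain ⟨h1, h2⟩ := exists_eq_fiberedIdeal hs hs3 hi hit hA hB hK.symm hcl hfull
        exact Or.inr ⟨t, s, i + 1, hs, hs3, by omega, h1, h2⟩

/-! ### Degrees of the parameters -/

theorem HasParameterDegrees.fullRadical {I : Ideal H} {p q : ℕ} (h : HasParameterDegrees I p q) :
    FullRadical I := by
  obtain ⟨-, -, X, Y, hX, hY, rfl, hfin⟩ := h
  exact FullRadical.of_finite hX hY hfin

theorem HasParameterDegrees.eq_or_swap {C D : H} {c d p q : ℕ} (hC : (C : Poly).IsHomogeneous c)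
    (hD : (D : Poly).IsHomogeneous d) (hc : 0 < c) (hd : 0 < d) (hcd : c ≠ d)
    (h : HasParameterDegrees (Ideal.span {C, D}) p q) : (p = c ∧ q = d) ∨ (p = d ∧ q = c) := by
  have hfull := h.fullRadical
  obtain ⟨-, -, X, Y, hX, hY, hXY, -⟩ := h
  rcases Nat.lt_or_gt_of_ne hcd with hlt | hlt
  · rcases generators_of_span_eq hC hD hlt hX hY (ne_zero_of_isRelPrime hfull.isRelPrime hD hd)
      (hfull.notMem_span_singleton hC hc) hXY with h | h
    · exact Or.inl ⟨h.1, h.2.1⟩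
    · exact Or.inr ⟨h.1, h.2.1⟩
  · rw [Set.pair_comm] at hXY hfull
    rcases generators_of_span_eq hD hC hlt hX hY (ne_zero_of_isRelPrime hfull.isRelPrime hC hc)
      (hfull.notMem_span_singleton hD hd) hXY with h | h
    · exact Or.inr ⟨h.1, h.2.1⟩
    · exact Or.inl ⟨h.1, h.2.1⟩

theorem chainIdeal_hasParameterDegrees {n t i : ℕ} (hi : 1 ≤ i) :
    HasParameterDegrees (chainIdeal n t i) (3 * i + (2 ^ (n + 1) - 2) * (2 * 2 ^ t))
      ((2 ^ (n + 1) - 2) * (2 * 2 ^ t) + 2 * 2 ^ t) :=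
  ⟨by omega, by positivity, _, _, v_pow_mul_isHomogeneous n t i, x_succ_pow_isHomogeneous n t, rfl,
    (chainIdeal_fullRadical n t i).finite⟩

theorem fiberedIdeal_hasParameterDegrees {k l : ℕ} (hk : 1 ≤ k) (hl : 1 ≤ l) :
    HasParameterDegrees (fiberedIdeal (k, l)) (3 * k) (2 * l) :=
  ⟨by omega, by omega, _, _, isHomogeneous_v.pow k, isHomogeneous_u.pow l, rfl,
    (fiberedIdeal_fullRadical (k, l)).finite⟩

/-- The degrees of the parameters of a chain ideal, in a form free of subtraction. -/
theorem chainIdeal_degrees {n t i p q : ℕ} (hi : 1 ≤ i) (hit : i ≤ 2 ^ t)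
    (h : HasParameterDegrees (chainIdeal n t i) p q) :
    (p + 4 * 2 ^ t = 3 * i + 4 * (2 ^ t * 2 ^ n) ∧ q + 2 * 2 ^ t = 4 * (2 ^ t * 2 ^ n)) ∨
      (q + 4 * 2 ^ t = 3 * i + 4 * (2 ^ t * 2 ^ n) ∧ p + 2 * 2 ^ t = 4 * (2 ^ t * 2 ^ n)) := by
  have hne := three_mul_ne (s := 1) hi hit
  rw [mul_one] at hne
  have hpos : 0 < 2 ^ t := by positivity
  have e : (2 ^ (n + 1) - 2) * (2 * 2 ^ t) + 4 * 2 ^ t = 4 * (2 ^ t * 2 ^ n) := by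
    obtain ⟨k, hk⟩ := Nat.exists_eq_add_of_le (Nat.one_le_two_pow (n := n))
    rw [pow_succ, hk, show (1 + k) * 2 - 2 = 2 * k by omega]
    ring
  rcases HasParameterDegrees.eq_or_swap (v_pow_mul_isHomogeneous n t i)
    (x_succ_pow_isHomogeneous n t) (by omega) (by omega) (by omega) h with h | h
  · left; omega
  · right; omega

theorem fiberedIdeal_degrees {t s k p q : ℕ} (hs : Odd s) (hk : 1 ≤ k) (hkt : k ≤ 2 ^ t)
    (h : HasParameterDegrees (fiberedIdeal (k, 2 ^ t * s)) p q) :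
    (p = 3 * k ∧ q = 2 * (2 ^ t * s)) ∨ (q = 3 * k ∧ p = 2 * (2 ^ t * s)) := by
  have hpos : 0 < 2 ^ t * s := Nat.mul_pos (by positivity) hs.pos
  rcases HasParameterDegrees.eq_or_swap (isHomogeneous_v.pow k) (isHomogeneous_u.pow (2 ^ t * s))
    (by omega) (by omega) (three_mul_ne hk hkt) h with h | h
  · left; omega
  · right; omega

theorem eq_of_two_pow_mul_odd_eq {a b r s : ℕ} (hr : Odd r) (hs : Odd s)
    (h : 2 ^ a * r = 2 ^ b * s) : a = b := by
  have key : ∀ {a b r s : ℕ}, Odd s → 2 ^ a * r = 2 ^ b * s → a ≤ b := by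
    intro a b r s hs h
    have h1 : 2 ^ a ∣ 2 ^ b * s := ⟨r, h.symm⟩
    have h2 : Nat.Coprime (2 ^ a) s := Nat.Coprime.pow_left _ hs.coprime_two_left
    exact (Nat.pow_dvd_pow_iff_le_right (by norm_num)).1 (h2.dvd_of_dvd_mul_right h1)
  exact le_antisymm (key hs h) (key hr h.symm)

/-- A multiple `3i` with `1 ≤ i ≤ 2^t` is not divisible by `2^{t+1}`. -/
theorem not_dvd_three_mul {i t : ℕ} (hi : 1 ≤ i) (hit : i ≤ 2 ^ t) : ¬ 2 * 2 ^ t ∣ 3 * i := by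
  rintro ⟨s, h⟩
  exact three_mul_ne hi hit (s := s) (by rw [h]; ring)

theorem chainIdeal_index_unique {n t i n' t' i' p q : ℕ} (hi : 1 ≤ i) (hit : i ≤ 2 ^ t)
    (hi' : 1 ≤ i') (hit' : i' ≤ 2 ^ t')
    (h : HasParameterDegrees (chainIdeal n t i) p q)
    (h' : HasParameterDegrees (chainIdeal n' t' i') p q) : n = n' ∧ t = t' ∧ i = i' := by
  -- the degrees cannot be matched crosswise
  have cross : ∀ {n t i n' t' i' p q : ℕ}, 1 ≤ i → i ≤ 2 ^ t → t ≤ t' →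
      p + 4 * 2 ^ t = 3 * i + 4 * (2 ^ t * 2 ^ n) → p + 2 * 2 ^ t' = 4 * (2 ^ t' * 2 ^ n') →
      q + 4 * 2 ^ t' = 3 * i' + 4 * (2 ^ t' * 2 ^ n') → False := by
    intro n t i n' t' i' p q hi hit htt h1 h2 h3
    apply not_dvd_three_mul hi hit
    obtain ⟨c, hc⟩ := pow_dvd_pow 2 htt
    have hp : 2 * 2 ^ t ∣ p := by
      have h4 : 2 * 2 ^ t ∣ p + 2 * 2 ^ t' := by
        rw [h2, hc]; exact ⟨2 * (c * 2 ^ n'), by ring⟩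
      exact (Nat.dvd_add_left (by rw [hc]; exact ⟨c, by ring⟩)).1 h4
    have h5 : 2 * 2 ^ t ∣ 3 * i + 4 * (2 ^ t * 2 ^ n) := by
      rw [← h1]
      exact dvd_add hp ⟨2, by ring⟩
    exact (Nat.dvd_add_left ⟨2 * 2 ^ n, by ring⟩).1 h5
  have same : ∀ {p q : ℕ}, p + 4 * 2 ^ t = 3 * i + 4 * (2 ^ t * 2 ^ n) →
      q + 2 * 2 ^ t = 4 * (2 ^ t * 2 ^ n) → p + 4 * 2 ^ t' = 3 * i' + 4 * (2 ^ t' * 2 ^ n') →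
      q + 2 * 2 ^ t' = 4 * (2 ^ t' * 2 ^ n') → n = n' ∧ t = t' ∧ i = i' := by
    intro p q h1 h2 h3 h4
    obtain ⟨k, hk⟩ := Nat.exists_eq_add_of_le (Nat.one_le_two_pow (n := n))
    obtain ⟨k', hk'⟩ := Nat.exists_eq_add_of_le (Nat.one_le_two_pow (n := n'))
    have h5 : 2 ^ t * (2 * k + 1) = 2 ^ t' * (2 * k' + 1) := by
      rw [hk] at h2
      rw [hk'] at h4
      ring_nf at h2 h4 ⊢
      omega
    obtain rfl := eq_of_two_pow_mul_odd_eq (odd_two_mul_add_one k) (odd_two_mul_add_one k') h5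
    have h6 : 2 ^ t * 2 ^ n = 2 ^ t * 2 ^ n' := by omega
    have h7 := Nat.eq_of_mul_eq_mul_left (by positivity) h6
    exact ⟨Nat.pow_right_injective le_rfl h7, rfl, by omega⟩
  rcases chainIdeal_degrees hi hit h with ⟨h1, h2⟩ | ⟨h1, h2⟩ <;>
    rcases chainIdeal_degrees hi' hit' h' with ⟨h3, h4⟩ | ⟨h3, h4⟩
  · exact same h1 h2 h3 h4
  · exfalso
    rcases le_total t t' with htt | htt
    · exact cross hi hit htt h1 h4 h3
    · exact cross hi' hit' htt h3 h2 h1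
  · exfalso
    rcases le_total t t' with htt | htt
    · exact cross hi hit htt h1 h4 h3
    · exact cross hi' hit' htt h3 h2 h1
  · exact same h1 h2 h3 h4

theorem fiberedIdeal_index_unique {t s k t' s' k' p q : ℕ} (hs : Odd s) (hs' : Odd s')
    (hk : 1 ≤ k) (hkt : k ≤ 2 ^ t) (hk' : 1 ≤ k') (hkt' : k' ≤ 2 ^ t')
    (h : HasParameterDegrees (fiberedIdeal (k, 2 ^ t * s)) p q)
    (h' : HasParameterDegrees (fiberedIdeal (k', 2 ^ t' * s')) p q) :
    k = k' ∧ 2 ^ t * s = 2 ^ t' * s' := by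
  have cross : ∀ {t k t' s' : ℕ}, 1 ≤ k → k ≤ 2 ^ t → t ≤ t' → 3 * k = 2 * (2 ^ t' * s') →
      False := by
    intro t k t' s' hk hkt htt h
    apply not_dvd_three_mul hk hkt
    obtain ⟨c, hc⟩ := pow_dvd_pow 2 htt
    rw [h, hc]
    exact ⟨c * s', by ring⟩
  rcases fiberedIdeal_degrees hs hk hkt h with ⟨h1, h2⟩ | ⟨h1, h2⟩ <;>
    rcases fiberedIdeal_degrees hs' hk' hkt' h' with ⟨h3, h4⟩ | ⟨h3, h4⟩
  · omega
  · exfalso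
    rcases le_total t t' with htt | htt
    · exact cross hk hkt htt (s' := s') (by omega)
    · exact cross hk' hkt' htt (s' := s) (by omega)
  · exfalso
    rcases le_total t t' with htt | htt
    · exact cross hk hkt htt (s' := s') (by omega)
    · exact cross hk' hkt' htt (s' := s) (by omega)
  · omega

theorem fiberedIdeal_chainIdeal_degrees_ne {t s k n t' i p q : ℕ} (hs : Odd s) (hk : 1 ≤ k)
    (hkt : k ≤ 2 ^ t) (hn : 1 ≤ n) (hi : 1 ≤ i) (hit : i ≤ 2 ^ t')
    (h : HasParameterDegrees (fiberedIdeal (k, 2 ^ t * s)) p q)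
    (h' : HasParameterDegrees (chainIdeal n t' i) p q) : False := by
  obtain ⟨m, rfl⟩ : ∃ m, n = m + 1 := ⟨n - 1, by omega⟩
  obtain ⟨c, hc⟩ := Nat.exists_eq_add_of_le (Nat.one_le_two_pow (n := m))
  have e : 2 ^ t' * 2 ^ (m + 1) = 2 * 2 ^ t' + 2 * (2 ^ t' * c) := by
    rw [pow_succ, hc]; ring
  -- the degree of `v^k` is that of the first generator of the chain ideal
  have parallel : ∀ {p q : ℕ}, p = 3 * k → q = 2 * (2 ^ t * s) →
      p + 4 * 2 ^ t' = 3 * i + 4 * (2 ^ t' * 2 ^ (m + 1)) →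
      q + 2 * 2 ^ t' = 4 * (2 ^ t' * 2 ^ (m + 1)) → False := by
    intro p q h1 h2 h3 h4
    have h5 : 2 ^ t * s = 2 ^ t' * (2 * (1 + 2 * c) + 1) := by
      rw [mul_add, mul_one, mul_left_comm, mul_add, mul_one, mul_left_comm]
      omega
    obtain rfl := eq_of_two_pow_mul_odd_eq hs (odd_two_mul_add_one _) h5
    omega
  have crosswise : ∀ {p q : ℕ}, p = 3 * k → q = 2 * (2 ^ t * s) →
      q + 4 * 2 ^ t' = 3 * i + 4 * (2 ^ t' * 2 ^ (m + 1)) →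
      p + 2 * 2 ^ t' = 4 * (2 ^ t' * 2 ^ (m + 1)) → False := by
    intro p q h1 h2 h3 h4
    have h5 : 2 ^ t' < 2 ^ t := by
      have : 0 < 2 ^ t' := by positivity
      omega
    have h6 := (Nat.pow_lt_pow_iff_right (a := 2) (by norm_num)).1 h5
    obtain ⟨j, hj⟩ := pow_dvd_pow 2 h6.le
    apply not_dvd_three_mul hi hit
    have h7 : 2 * 2 ^ t' ∣ 3 * i + 4 * (2 ^ t' * 2 ^ (m + 1)) := by
      rw [← h3, h2, hj]
      exact ⟨j * s + 2, by ring⟩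
    exact (Nat.dvd_add_left ⟨2 * 2 ^ (m + 1), by ring⟩).1 h7
  rcases fiberedIdeal_degrees hs hk hkt h with ⟨h1, h2⟩ | ⟨h1, h2⟩ <;>
    rcases chainIdeal_degrees hi hit h' with ⟨h3, h4⟩ | ⟨h3, h4⟩
  · exact parallel h1 h2 h3 h4
  · exact crosswise h1 h2 h3 h4
  · exact crosswise h1 h2 h3 h4
  · exact parallel h1 h2 h3 h4

/-! ### Indexing by the three families -/

theorem exists_of_mem_fiberedIndex {p : ℕ × ℕ} (hp : p ∈ fiberedIndex) :
    ∃ t s, Odd s ∧ p.2 = 2 ^ t * s ∧ 1 ≤ p.1 ∧ p.1 ≤ 2 ^ t := by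
  obtain ⟨h1, h2, h3⟩ := hp
  obtain ⟨t, s, hs, h⟩ := Nat.exists_eq_two_pow_mul_odd (n := p.2) (by omega)
  refine ⟨t, s, hs, h, h2, ?_⟩
  rwa [h, padicValNat.mul (by positivity) hs.pos.ne', padicValNat.prime_pow,
    padicValNat.eq_zero_of_not_dvd (fun hd => (Nat.not_even_iff_odd.2 hs) (even_iff_two_dvd.2 hd)),
    add_zero] at h3

theorem mem_fiberedIndex {t s k : ℕ} (hs : Odd s) (hk : 1 ≤ k) (hkt : k ≤ 2 ^ t) :
    (k, 2 ^ t * s) ∈ fiberedIndex := by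
  refine ⟨Nat.mul_pos (by positivity) hs.pos, hk, ?_⟩
  rwa [padicValNat.mul (by positivity) hs.pos.ne', padicValNat.prime_pow,
    padicValNat.eq_zero_of_not_dvd (fun hd => (Nat.not_even_iff_odd.2 hs) (even_iff_two_dvd.2 hd)),
    add_zero]

theorem twistedIdeal_eq (n : ℕ) : twistedIdeal (n + 1) = chainIdeal n 0 1 := by
  rw [twistedIdeal, chainIdeal, sq_one_x_succ, Set.pair_comm, pow_zero, mul_one, pow_one, pow_one]

theorem mixedIdeal_eq (n m i : ℕ) : mixedIdeal (n, m + 1, i) = chainIdeal n m i := by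
  rw [mixedIdeal, chainIdeal, Nat.add_sub_cancel, pow_succ']

theorem mixedIdeal_zero_eq (n m : ℕ) :
    mixedIdeal (n + 1, m + 1, 0) = chainIdeal n (m + 1) (2 ^ (m + 1)) := by
  rw [mixedIdeal, chainIdeal, Nat.add_sub_cancel]
  have e : x (n + 1 + 1) ^ 2 ^ m = v ^ 2 ^ (m + 1) * x n ^ (2 * 2 ^ (m + 1)) +
      u ^ 2 ^ m * x (n + 1) ^ 2 ^ (m + 1) := by
    rw [x_add_two, add_pow_char_pow]
    ring
  rw [e, pow_zero, one_mul, Ideal.span_pair_add_mul_left, Set.pair_comm]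

theorem exists_of_mem_mixedIndex {p : ℕ × ℕ × ℕ} (hp : p ∈ mixedIndex) :
    ∃ n t i, 1 ≤ n ∧ 1 ≤ i ∧ i ≤ 2 ^ t ∧ mixedIdeal p = chainIdeal n t i ∧
      ((p = (n, t + 1, i) ∧ i < 2 ^ t) ∨ (p = (n + 1, t, 0) ∧ 1 ≤ t ∧ i = 2 ^ t)) := by
  obtain ⟨n, m, i⟩ := p
  obtain ⟨hm, h⟩ := hp
  obtain ⟨m, rfl⟩ : ∃ m', m = m' + 1 := ⟨m - 1, by simp at hm; omega⟩
  simp only [Nat.add_sub_cancel] at h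
  rcases Nat.eq_zero_or_pos i with rfl | hi
  · obtain ⟨n, rfl⟩ : ∃ n', n = n' + 2 := ⟨n - 2, by omega⟩
    exact ⟨n + 1, m + 1, 2 ^ (m + 1), by omega, Nat.one_le_two_pow, le_rfl,
      mixedIdeal_zero_eq _ _, Or.inr ⟨rfl, by omega, rfl⟩⟩
  · exact ⟨n, m, i, by omega, hi, by omega, mixedIdeal_eq _ _ _, Or.inl ⟨rfl, by omega⟩⟩

theorem chainIdeal_mem {n t i : ℕ} (hn : 1 ≤ n) (hi : 1 ≤ i) (hit : i ≤ 2 ^ t) :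
    chainIdeal n t i ∈ twistedIdeals ∪ mixedIdeals := by
  rcases Nat.lt_or_eq_of_le hit with hlt | rfl
  · refine Or.inr ⟨(n, t + 1, i), ⟨by simp, ?_⟩, mixedIdeal_eq _ _ _⟩
    simp only [Nat.add_sub_cancel]
    omega
  · cases t with
    | zero => exact Or.inl ⟨n + 1, Nat.succ_le_succ hn, twistedIdeal_eq n⟩
    | succ t =>
      refine Or.inr ⟨(n + 1, t + 1, 0), ⟨by simp, Or.inr ⟨Nat.succ_le_succ hn, ?_⟩⟩,
        mixedIdeal_zero_eq _ _⟩
      simp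

theorem exists_of_mem_twistedIndex {n : ℕ} (hn : n ∈ twistedIndex) :
    ∃ m, 1 ≤ m ∧ n = m + 1 ∧ twistedIdeal n = chainIdeal m 0 1 := by
  have hn' : 2 ≤ n := hn
  obtain ⟨m, rfl⟩ : ∃ m, n = m + 1 := ⟨n - 1, by omega⟩
  exact ⟨m, by omega, rfl, twistedIdeal_eq m⟩

theorem fibered_or_chain {I : Ideal H} {p q : ℕ} (hcl : IsSteenrodClosed I)
    (h : HasParameterDegrees I p q) :
    (∃ t s k, Odd s ∧ 1 ≤ k ∧ k ≤ 2 ^ t ∧ I = fiberedIdeal (k, 2 ^ t * s)) ∨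
      (∃ n t i, 1 ≤ n ∧ 1 ≤ i ∧ i ≤ 2 ^ t ∧ I = chainIdeal n t i) := by
  have hfull := h.fullRadical
  obtain ⟨hp, hq, X, Y, hX, hY, hI, -⟩ := h
  rcases exists_eq_of_isSteenrodClosed _ rfl hcl hfull hX hY hp hq hI with
    ⟨n, t, i, hi, hit, h⟩ | ⟨t, s, i, hs, -, hi, hit, h⟩
  · rcases Nat.eq_zero_or_pos n with rfl | hn
    · refine Or.inl ⟨t, 1, i, odd_one, hi, hit, ?_⟩
      rw [h, chainIdeal_zero, mul_one]
    · exact Or.inr ⟨n, t, i, hn, hi, hit, h⟩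
  · exact Or.inl ⟨t, s, i, hs, hi, hit, h⟩

theorem fiberedIdeal_ne_chainIdeal {p : ℕ × ℕ} (hp : p ∈ fiberedIndex) {n t i : ℕ} (hn : 1 ≤ n)
    (hi : 1 ≤ i) (hit : i ≤ 2 ^ t) : fiberedIdeal p ≠ chainIdeal n t i := by
  intro h
  obtain ⟨t', s, hs, h2, hk, hkt⟩ := exists_of_mem_fiberedIndex hp
  obtain ⟨k, l⟩ := p
  simp only at h2 hk hkt
  subst h2
  have hd := fiberedIdeal_hasParameterDegrees hk hp.1
  exact fiberedIdeal_chainIdeal_degrees_ne hs hk hkt hn hi hit hd (by rw [← h]; exact hd)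

theorem chainIdeal_injective {n t i n' t' i' : ℕ} (hi : 1 ≤ i) (hit : i ≤ 2 ^ t)
    (hi' : 1 ≤ i') (hit' : i' ≤ 2 ^ t')
    (h : chainIdeal n t i = chainIdeal n' t' i') : n = n' ∧ t = t' ∧ i = i' :=
  chainIdeal_index_unique hi hit hi' hit' (chainIdeal_hasParameterDegrees hi)
    (by rw [← h]; exact chainIdeal_hasParameterDegrees hi)

end A4Cohomology

end

theorem theorem1p2 :
    -- the classification
    {I : Ideal A4Cohomology.H | A4Cohomology.IsSteenrodClosed I ∧ A4Cohomology.IsParameterIdeal I}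
      = A4Cohomology.fiberedIdeals ∪ A4Cohomology.twistedIdeals ∪ A4Cohomology.mixedIdeals ∧
    -- the three families are pairwise disjoint
    Disjoint A4Cohomology.fiberedIdeals A4Cohomology.twistedIdeals ∧
    Disjoint A4Cohomology.fiberedIdeals A4Cohomology.mixedIdeals ∧
    Disjoint A4Cohomology.twistedIdeals A4Cohomology.mixedIdeals ∧
    -- within each family, different indices give different ideals
    Set.InjOn A4Cohomology.fiberedIdeal A4Cohomology.fiberedIndex ∧
    Set.InjOn A4Cohomology.twistedIdeal A4Cohomology.twistedIndex ∧
    Set.InjOn A4Cohomology.mixedIdeal A4Cohomology.mixedIndex ∧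
    -- at most one such ideal for each pair of degrees
    (∀ (p q : ℕ) (I J : Ideal A4Cohomology.H),
      A4Cohomology.IsSteenrodClosed I → A4Cohomology.HasParameterDegrees I p q →
      A4Cohomology.IsSteenrodClosed J → A4Cohomology.HasParameterDegrees J p q → I = J) := by
  open A4Cohomology in
  refine ⟨?_, ?_, ?_, ?_, ?_, ?_, ?_, ?_⟩
  · ext I
    constructor
    · rintro ⟨hcl, p, q, h⟩
      rcases fibered_or_chain hcl h with ⟨t, s, k, hs, hk, hkt, rfl⟩ | ⟨n, t, i, hn, hi, hit, rfl⟩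
      · exact Or.inl (Or.inl ⟨_, mem_fiberedIndex hs hk hkt, rfl⟩)
      · rw [Set.union_assoc]
        exact Or.inr (chainIdeal_mem hn hi hit)
    · rintro ((⟨⟨k, l⟩, hp, rfl⟩ | ⟨n, hn, rfl⟩) | ⟨p, hp, rfl⟩)
      · obtain ⟨t, s, -, h2, -, hkt⟩ := exists_of_mem_fiberedIndex hp
        exact ⟨fiberedIdeal_isSteenrodClosed hkt ⟨s, h2⟩, _, _,
          fiberedIdeal_hasParameterDegrees hp.2.1 hp.1⟩
      · obtain ⟨m, -, -, h⟩ := exists_of_mem_twistedIndex hn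
        rw [h]
        exact ⟨chainIdeal_isSteenrodClosed Nat.one_le_two_pow, _, _,
          chainIdeal_hasParameterDegrees le_rfl⟩
      · obtain ⟨n, t, i, -, hi, hit, h, -⟩ := exists_of_mem_mixedIndex hp
        rw [h]
        exact ⟨chainIdeal_isSteenrodClosed hit, _, _, chainIdeal_hasParameterDegrees hi⟩
  · rw [Set.disjoint_left]
    rintro _ ⟨p, hp, rfl⟩ ⟨n, hn, h⟩
    obtain ⟨m, hm, -, h'⟩ := exists_of_mem_twistedIndex hn
    exact fiberedIdeal_ne_chainIdeal hp hm le_rfl Nat.one_le_two_pow (h.symm.trans h')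
  · rw [Set.disjoint_left]
    rintro _ ⟨p, hp, rfl⟩ ⟨p', hp', h⟩
    obtain ⟨n, t, i, hn, hi, hit, h', -⟩ := exists_of_mem_mixedIndex hp'
    exact fiberedIdeal_ne_chainIdeal hp hn hi hit (h.symm.trans h')
  · rw [Set.disjoint_left]
    rintro _ ⟨n, hn, rfl⟩ ⟨p, hp, h⟩
    obtain ⟨m, hm, -, h'⟩ := exists_of_mem_twistedIndex hn
    obtain ⟨n', t, i, hn', hi, hit, h'', hcase⟩ := exists_of_mem_mixedIndex hp
    obtain ⟨-, rfl, rfl⟩ := chainIdeal_injective le_rfl Nat.one_le_two_pow hi hit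
      (h'.symm.trans (h.symm.trans h''))
    rcases hcase with ⟨-, h1⟩ | ⟨-, h1, -⟩ <;> simp at h1
  · rintro ⟨k, l⟩ hp ⟨k', l'⟩ hp' h
    obtain ⟨t, s, hs, h2, hk, hkt⟩ := exists_of_mem_fiberedIndex hp
    obtain ⟨t', s', hs', h2', hk', hkt'⟩ := exists_of_mem_fiberedIndex hp'
    simp only at h2 h2' hk hk' hkt hkt'
    subst h2 h2'
    have hd := fiberedIdeal_hasParameterDegrees hk hp.1
    obtain ⟨h3, h4⟩ := fiberedIdeal_index_unique hs hs' hk hkt hk' hkt' hd (by rw [← h]; exact hd)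
    rw [h3, h4]
  · intro n hn n' hn' h
    obtain ⟨m, hm, rfl, h1⟩ := exists_of_mem_twistedIndex hn
    obtain ⟨m', hm', rfl, h1'⟩ := exists_of_mem_twistedIndex hn'
    obtain ⟨rfl, -, -⟩ := chainIdeal_injective le_rfl Nat.one_le_two_pow le_rfl Nat.one_le_two_pow
      (h1.symm.trans (h.trans h1'))
    rfl
  · intro p hp p' hp' h
    obtain ⟨n, t, i, hn, hi, hit, h1, hcase⟩ := exists_of_mem_mixedIndex hp
    obtain ⟨n', t', i', hn', hi', hit', h1', hcase'⟩ := exists_of_mem_mixedIndex hp'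
    obtain ⟨rfl, rfl, rfl⟩ := chainIdeal_injective hi hit hi' hit'
      (h1.symm.trans (h.trans h1'))
    rcases hcase with ⟨rfl, h2⟩ | ⟨rfl, -, h2⟩ <;>
      rcases hcase' with ⟨rfl, h2'⟩ | ⟨rfl, -, h2'⟩ <;>
      first
      | rfl
      | omega
  · intro p q I J hI hIp hJ hJp
    rcases fibered_or_chain hI hIp with ⟨t, s, k, hs, hk, hkt, rfl⟩ | ⟨n, t, i, hn, hi, hit, rfl⟩ <;>
      rcases fibered_or_chain hJ hJp with
        ⟨t', s', k', hs', hk', hkt', rfl⟩ | ⟨n', t', i', hn', hi', hit', rfl⟩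
    · obtain ⟨h3, h4⟩ := fiberedIdeal_index_unique hs hs' hk hkt hk' hkt' hIp hJp
      rw [h3, h4]
    · exact (fiberedIdeal_chainIdeal_degrees_ne hs hk hkt hn' hi' hit' hIp hJp).elim
    · exact (fiberedIdeal_chainIdeal_degrees_ne hs' hk' hkt' hn hi hit hJp hIp).elim
    · obtain ⟨rfl, rfl, rfl⟩ := chainIdeal_index_unique hi hit hi' hit' hIp hJp
      rfl
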